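/- **Setting.** Let $M=L^*+S^*\in\mathbb{R}^{n_1\times n_2}$, where $L^*$ has rank $r\ge 1$ and compact singular value decomposition $L^*=U^*\Sigma^*V^{*T}$ with singular values $\sigma_1^*\ge\dots\ge\sigma_r^*>0$, $\kappa=\sigma_1^*/\sigma_r^*$, and $S^*$ has at most an $\alpha$-fraction of non-zero entries in each row and in each column. Let $X\in\mathbb{R}^{n_1\times d_1}$, $Y\in\mathbb{R}^{n_2\times d_2}$ satisfy $X^TX=I$, $Y^TY=I$, $\mathrm{col}(U^*)\subseteq\mathrm{col}(X)$, $\mathrm{col}(V^*)\subseteq\mathrm{col}(Y)$, and put $d=\max(d_1,d_2)$, $P^*=X^TU^*\Sigma^{*1/2}$, $Q^*=Y^TV^*\Sigma^{*1/2}$. Write $\|\cdot\|_2$ for the spectral norm, $\|\cdot\|_{2,\infty}$ for the maximum of the Euclidean norms of the rows, and $$d(A,B,A',B')=\min_{R}\sqrt{\|A-A'R\|_F^2+\|B-B'R\|_F^2},$$ the minimum being over orthogonal $R\in\mathbb{R}^{r\times r}$. Consider the incoherence conditions (a) $\|U^*\|_{2,\infty}\le\sqrt{\mu_1r/n_1}$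 and $\|V^*\|_{2,\infty}\le\sqrt{\mu_1r/n_2}$; (b) $\|X\|_{2,\infty}\le\sqrt{\mu_2d_1/n_1}$ and $\|Y\|_{2,\infty}\le\sqrt{\mu_2d_2/n_2}$. In case (i), (a) holds; in case (ii), (b) holds; in case (iii), both hold. **Algorithm.** For a matrix $A\in\mathbb{R}^{n_1\times n_2}$, $\mathcal{T}_\theta(A)$ keeps the entries that are among the $\lfloor\theta n_2\rfloor$ largest in absolute value of their row and among the $\lfloor\theta n_1\rfloor$ largest in absolute value of their column, and sets all others to $0$; ties are broken arbitrarily. Put $S_0=\mathcal{T}_\alpha(M)$, $L_0=M-S_0$, let $U_0\Sigma_0V_0^T$ be an $r$-truncated singular value decomposition of $L_0$, and let $P_0=X^TU_0\Sigma_0^{1/2}$, $Q_0=Y^TV_0\Sigma_0^{1/2}$. In case (i) let $$\mathcal{P}=\{A\in\mathbb{R}^{d_1\times r}:\|XA\|_{2,\infty}\le\sqrt{2\mu_1r/n_1}\,\|P_0\|_2\},\qquad \mathcal{Q}=\{A\in\mathbb{R}^{d_2\times r}:\|YA\|_{2,\infty}\le\sqrt{2\mu_1r/n_2}\,\|Q_0\|_2\};$$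 in cases (ii) and (iii) let $\mathcal{P}=\mathbb{R}^{d_1\times r}$, $\mathcal{Q}=\mathbb{R}^{d_2\times r}$. Let $\Pi_{\mathcal P},\Pi_{\mathcal Q}$ be the Frobenius-norm projections. Start from $\bar P_0=\Pi_{\mathcal P}(P_0)$, $\bar Q_0=\Pi_{\mathcal Q}(Q_0)$, and for $t\ge0$ put $$S=\mathcal{T}_{\alpha+\min(10\alpha,\,0.1)}(M-X\bar P_t\bar Q_t^TY^T),\quad \bar P_{t+1}=\Pi_{\mathcal P}(\bar P_t-\eta\nabla_P\mathcal L(\bar P_t,\bar Q_t)),\quad \bar Q_{t+1}=\Pi_{\mathcal Q}(\bar Q_t-\eta\nabla_Q\mathcal L(\bar P_t,\bar Q_t)),$$ where $\mathcal L(P,Q)=\frac12\|XPQ^TY^T+S-M\|_F^2+\frac1{64}\|P^TP-Q^TQ\|_F^2$. **Theorem.** There exist absolute constants $c_1,\dots,c_6>0$ such that, in every such setting, for every step size $0<\eta\le\frac{1}{192\|L_0\|_2}$ and every choice made in breaking ties and in the truncated singular value decomposition, the following holds for all $t\ge 0$. - In case (i), if $\alpha\le\dfrac{c_1}{\mu_1(\kappa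 r)^{3/2}}$, then $d(\bar P_t,\bar Q_t,P^*,Q^*)^2\le(1-c_2\eta\sigma_r^*)^t\,\Delta$. - In case (ii), if $\alpha\le\dfrac{c_3}{\mu_2\,d\,r^{1/2}\kappa^{3/2}}$, then $d(\bar P_t,\bar Q_t,P^*,Q^*)^2\le(1-c_4\eta\sigma_r^*)^t\,\Delta$. - In case (iii), if $\alpha\le c_5\min\Big(\dfrac{1}{\mu_2d\kappa},\dfrac{1}{\mu_1(\kappa r)^{3/2}}\Big)$, then $d(\bar P_t,\bar Q_t,P^*,Q^*)^2\le(1-c_6\eta\sigma_r^*)^t\,\Delta$. Here the bounds hold both with $\Delta=d(\bar P_0,\bar Q_0,P^*,Q^*)^2$ and with $\Delta=d(P_0,Q_0,P^*,Q^*)^2$ (in cases (ii) and (iii) these agree). -/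

import Mathlib

open scoped Matrix

namespace RPCAF

noncomputable section

/-- Squared Frobenius norm. -/
def frobSq {m n : ℕ} (A : Matrix (Fin m) (Fin n) ℝ) : ℝ :=
  ∑ i, ∑ j, A i j ^ 2

/-- Spectral norm (largest singular value): the operator norm between Euclidean spaces. -/
def specNorm {m n : ℕ} (A : Matrix (Fin m) (Fin n) ℝ) : ℝ :=
  ‖LinearMap.toContinuousLinearMap (Matrix.toEuclideanLin A)‖

/-- The maximum of the Euclidean norms of the rows. -/
def twoInfNorm {m n : ℕ} (A : Matrix (Fin m) (Fin n) ℝ) : ℝ :=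
  ⨆ i : Fin m, Real.sqrt (∑ j, A i j ^ 2)

/-- The rotation-invariant distance between the pairs `(A, B)` and `(A', B')`:
the minimum over orthogonal `R` of `√(‖A - A' R‖_F² + ‖B - B' R‖_F²)`. -/
def pairDist {m n r : ℕ} (A : Matrix (Fin m) (Fin r) ℝ) (B : Matrix (Fin n) (Fin r) ℝ)
    (A' : Matrix (Fin m) (Fin r) ℝ) (B' : Matrix (Fin n) (Fin r) ℝ) : ℝ :=
  ⨅ R : Matrix.orthogonalGroup (Fin r) ℝ,
    Real.sqrt (frobSq (A - A' * (R : Matrix (Fin r) (Fin r) ℝ)) +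
      frobSq (B - B' * (R : Matrix (Fin r) (Fin r) ℝ)))

/-- `A = U diag(s) Vᵀ` is a singular value decomposition: orthonormal columns, and
non-negative singular values in non-increasing order. -/
structure IsSVD {m n p : ℕ} (A : Matrix (Fin m) (Fin n) ℝ) (U : Matrix (Fin m) (Fin p) ℝ)
    (s : Fin p → ℝ) (V : Matrix (Fin n) (Fin p) ℝ) : Prop where
  orthU : Uᵀ * U = 1
  orthV : Vᵀ * V = 1
  nonneg : ∀ i, 0 ≤ s i
  anti : Antitone s
  eq : A = U * Matrix.diagonal s * Vᵀ

/-- `(U, s, V)` is an `r`-truncated singular value decomposition of `A`: the part belonging to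
the `r` largest singular values in some singular value decomposition of `A`. -/
def IsTruncSVD {m n r : ℕ} (A : Matrix (Fin m) (Fin n) ℝ) (U : Matrix (Fin m) (Fin r) ℝ)
    (s : Fin r → ℝ) (V : Matrix (Fin n) (Fin r) ℝ) : Prop :=
  ∃ (p : ℕ) (h : r ≤ p) (U' : Matrix (Fin m) (Fin p) ℝ) (s' : Fin p → ℝ)
    (V' : Matrix (Fin n) (Fin p) ℝ), IsSVD A U' s' V' ∧
      U = U'.submatrix id (Fin.castLE h) ∧ s = s' ∘ Fin.castLE h ∧
      V = V'.submatrix id (Fin.castLE h)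

/-- `T` consists of the `⌊θ n⌋` entries of `a` that are largest in absolute value, ties being
broken in some way. -/
def IsTopFraction {n : ℕ} (θ : ℝ) (a : Fin n → ℝ) (T : Finset (Fin n)) : Prop :=
  T.card = min ⌊θ * n⌋₊ n ∧ ∀ i ∈ T, ∀ j ∉ T, |a j| ≤ |a i|

open Classical in
/-- `S` arises from `A` by hard thresholding at level `θ`: the entries that are among the
`θ`-fraction of largest entries (in absolute value) both of their row and of their column are
kept, all others are set to zero; ties are broken arbitrarily. -/
def IsHardThreshold {m n : ℕ} (θ : ℝ) (A S : Matrix (Fin m) (Fin n) ℝ) : Prop :=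
  ∃ (row : Fin m → Finset (Fin n)) (col : Fin n → Finset (Fin m)),
    (∀ i, IsTopFraction θ (fun j => A i j) (row i)) ∧
    (∀ j, IsTopFraction θ (fun i => A i j) (col j)) ∧
    ∀ i j, S i j = if j ∈ row i ∧ i ∈ col j then A i j else 0

/-- `B` is a Frobenius-nearest point to `A` in the set `K`. -/
def IsProj {m n : ℕ} (K : Set (Matrix (Fin m) (Fin n) ℝ)) (A B : Matrix (Fin m) (Fin n) ℝ) :
    Prop :=
  B ∈ K ∧ ∀ C ∈ K, frobSq (B - A) ≤ frobSq (C - A)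

/-- The objective `½‖X P Qᵀ Yᵀ + S - M‖_F² + (1/64)‖Pᵀ P - Qᵀ Q‖_F²`. -/
def loss {n₁ n₂ d₁ d₂ r : ℕ} (M S : Matrix (Fin n₁) (Fin n₂) ℝ)
    (X : Matrix (Fin n₁) (Fin d₁) ℝ) (Y : Matrix (Fin n₂) (Fin d₂) ℝ)
    (P : Matrix (Fin d₁) (Fin r) ℝ) (Q : Matrix (Fin d₂) (Fin r) ℝ) : ℝ :=
  1 / 2 * frobSq (X * P * Qᵀ * Yᵀ + S - M) + 1 / 64 * frobSq (Pᵀ * P - Qᵀ * Q)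

/-- The gradient of a function of a matrix: the matrix of its partial derivatives with respect
to the entries. -/
def matGrad {m n : ℕ} (f : Matrix (Fin m) (Fin n) ℝ → ℝ) (A : Matrix (Fin m) (Fin n) ℝ) :
    Matrix (Fin m) (Fin n) ℝ :=
  Matrix.of fun i j => deriv (fun t : ℝ => f (A + t • Matrix.single i j (1 : ℝ))) 0

/-- The setting: a low-rank matrix `L` of rank `r ≥ 1` with compact singular value decomposition
`U diag(σ) Vᵀ`, a sparse matrix `S` with at most an `α`-fraction of non-zero entries in each row
and each column, and feasible feature matrices `X`, `Y` with orthonormal columns. -/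
structure Setting (n₁ n₂ d₁ d₂ r : ℕ) where
  L : Matrix (Fin n₁) (Fin n₂) ℝ
  S : Matrix (Fin n₁) (Fin n₂) ℝ
  X : Matrix (Fin n₁) (Fin d₁) ℝ
  Y : Matrix (Fin n₂) (Fin d₂) ℝ
  U : Matrix (Fin n₁) (Fin r) ℝ
  σ : Fin r → ℝ
  V : Matrix (Fin n₂) (Fin r) ℝ
  α : ℝ
  r_pos : 0 < r
  svd : IsSVD L U σ V
  σ_pos : ∀ i, 0 < σ i
  row_sparse : ∀ i, ((Finset.univ.filter fun j => S i j ≠ 0).card : ℝ) ≤ α * n₂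
  col_sparse : ∀ j, ((Finset.univ.filter fun i => S i j ≠ 0).card : ℝ) ≤ α * n₁
  orthX : Xᵀ * X = 1
  orthY : Yᵀ * Y = 1
  feasX : LinearMap.range U.mulVecLin ≤ LinearMap.range X.mulVecLin
  feasY : LinearMap.range V.mulVecLin ≤ LinearMap.range Y.mulVecLin

namespace Setting

variable {n₁ n₂ d₁ d₂ r : ℕ} (D : Setting n₁ n₂ d₁ d₂ r)

/-- The observed matrix. -/
def M : Matrix (Fin n₁) (Fin n₂) ℝ := D.L + D.S

/-- The largest singular value of the low-rank component. -/
def σ₁ : ℝ := D.σ ⟨0, D.r_pos⟩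

/-- The smallest non-zero (that is, the `r`-th) singular value of the low-rank component. -/
def σr : ℝ := D.σ ⟨r - 1, Nat.sub_lt D.r_pos Nat.one_pos⟩

/-- The condition number of the low-rank component. -/
def κ : ℝ := D.σ₁ / D.σr

/-- The target factor `P* = Xᵀ U Σ^{1/2}`. -/
def Pstar : Matrix (Fin d₁) (Fin r) ℝ :=
  D.Xᵀ * D.U * Matrix.diagonal fun i => Real.sqrt (D.σ i)

/-- The target factor `Q* = Yᵀ V Σ^{1/2}`. -/
def Qstar : Matrix (Fin d₂) (Fin r) ℝ :=
  D.Yᵀ * D.V * Matrix.diagonal fun i => Real.sqrt (D.σ i)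

/-- Incoherence of the singular vectors. -/
def IncoherentSVD (μ₁ : ℝ) : Prop :=
  twoInfNorm D.U ≤ Real.sqrt (μ₁ * r / n₁) ∧ twoInfNorm D.V ≤ Real.sqrt (μ₁ * r / n₂)

/-- Incoherence of the features. -/
def IncoherentFeatures (μ₂ : ℝ) : Prop :=
  twoInfNorm D.X ≤ Real.sqrt (μ₂ * d₁ / n₁) ∧ twoInfNorm D.Y ≤ Real.sqrt (μ₂ * d₂ / n₂)

/-- A possible outcome of the first phase of the algorithm: `S₀` is a hard thresholding of `M` at
level `α`, and `P₀ = Xᵀ U₀ Σ₀^{1/2}`, `Q₀ = Yᵀ V₀ Σ₀^{1/2}` for an `r`-truncated singular value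
decomposition `U₀ Σ₀ V₀ᵀ` of `L₀ = M - S₀`. -/
def IsStart (L₀ : Matrix (Fin n₁) (Fin n₂) ℝ)
    (P₀ : Matrix (Fin d₁) (Fin r) ℝ) (Q₀ : Matrix (Fin d₂) (Fin r) ℝ) : Prop :=
  ∃ (S₀ : Matrix (Fin n₁) (Fin n₂) ℝ) (U₀ : Matrix (Fin n₁) (Fin r) ℝ) (s₀ : Fin r → ℝ)
    (V₀ : Matrix (Fin n₂) (Fin r) ℝ),
    IsHardThreshold D.α D.M S₀ ∧ L₀ = D.M - S₀ ∧ IsTruncSVD L₀ U₀ s₀ V₀ ∧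
    P₀ = D.Xᵀ * U₀ * (Matrix.diagonal fun i => Real.sqrt (s₀ i)) ∧
    Q₀ = D.Yᵀ * V₀ * (Matrix.diagonal fun i => Real.sqrt (s₀ i))

/-- The constraint set `{A | ‖X A‖_{2,∞} ≤ √(2 μ₁ r / n₁) ‖P₀‖₂}`. -/
def setP (μ₁ : ℝ) (P₀ : Matrix (Fin d₁) (Fin r) ℝ) : Set (Matrix (Fin d₁) (Fin r) ℝ) :=
  {A | twoInfNorm (D.X * A) ≤ Real.sqrt (2 * μ₁ * r / n₁) * specNorm P₀}

/-- The constraint set `{A | ‖Y A‖_{2,∞} ≤ √(2 μ₁ r / n₂) ‖Q₀‖₂}`. -/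
def setQ (μ₁ : ℝ) (Q₀ : Matrix (Fin d₂) (Fin r) ℝ) : Set (Matrix (Fin d₂) (Fin r) ℝ) :=
  {A | twoInfNorm (D.Y * A) ≤ Real.sqrt (2 * μ₁ * r / n₂) * specNorm Q₀}

/-- `(P t, Q t)` are the iterates of the second phase, with constraint sets `KP`, `KQ` and step
size `η`: first `P₀`, `Q₀` are projected onto the constraint sets; each iteration updates the
sparse estimate by hard thresholding the residual at level `α + min (10 α) 0.1` and then performs
a projected gradient step in both factors. -/
structure IsDescent (KP : Set (Matrix (Fin d₁) (Fin r) ℝ)) (KQ : Set (Matrix (Fin d₂) (Fin r) ℝ))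
    (η : ℝ) (P₀ : Matrix (Fin d₁) (Fin r) ℝ) (Q₀ : Matrix (Fin d₂) (Fin r) ℝ)
    (P : ℕ → Matrix (Fin d₁) (Fin r) ℝ) (Q : ℕ → Matrix (Fin d₂) (Fin r) ℝ) : Prop where
  startP : IsProj KP P₀ (P 0)
  startQ : IsProj KQ Q₀ (Q 0)
  step : ∀ t, ∃ S : Matrix (Fin n₁) (Fin n₂) ℝ,
    IsHardThreshold (D.α + min (10 * D.α) 0.1) (D.M - D.X * P t * (Q t)ᵀ * D.Yᵀ) S ∧
    IsProj KP (P t - η • matGrad (fun A => loss D.M S D.X D.Y A (Q t)) (P t)) (P (t + 1)) ∧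
    IsProj KQ (Q t - η • matGrad (fun B => loss D.M S D.X D.Y (P t) B) (Q t)) (Q (t + 1))

/-- Linear convergence with rate `ρ`: the squared distance to the target after `t` iterations is
at most `ρ ^ t` times the squared distance at the start, both when the start is taken to be the
pair `(P 0, Q 0)` that enters the first iteration and when it is taken to be the output
`(P₀, Q₀)` of the first phase, before the projection. -/
def LinearConvergence (ρ : ℝ) (P₀ : Matrix (Fin d₁) (Fin r) ℝ) (Q₀ : Matrix (Fin d₂) (Fin r) ℝ)
    (P : ℕ → Matrix (Fin d₁) (Fin r) ℝ) (Q : ℕ → Matrix (Fin d₂) (Fin r) ℝ) : Prop :=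
  ∀ t : ℕ,
    pairDist (P t) (Q t) D.Pstar D.Qstar ^ 2 ≤
      ρ ^ t * pairDist (P 0) (Q 0) D.Pstar D.Qstar ^ 2 ∧
    pairDist (P t) (Q t) D.Pstar D.Qstar ^ 2 ≤
      ρ ^ t * pairDist P₀ Q₀ D.Pstar D.Qstar ^ 2

end Setting

end

end RPCAF

namespace RPCAF

/-! The whole argument takes place in a ball around the orbit of the target factors under rotation:
with `δ` the squared distance, the first phase lands in `δ ≤ σr / 200`, and inside this ball every
projected gradient step multiplies `δ` by at most `1 - η σr / 50`.

Contraction. Fix the rotation that realises the distance at the current iterate, write `H = X P Qᵀ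
Yᵀ - L` and let `D = X P Qᵀ Yᵀ + S - M` be the residual that drives the gradient. Three facts are
combined in `descent_step`. (1) Thresholding at level `11 α` makes `D` agree with `H` outside a `12
α`-sparse set and keeps the error on that set small (`threshold_residual`). On the sparse set
incoherence gives `H` only a small multiple of `σr δ` of mass (`IsSparse.sum_sq_le`), so `D`
correlates with `H` almost as well as `H` itself. (2) At the optimal rotation the cross-Gram matrix
is symmetric and positive semidefinite (`exists_procrustes`). This yields the curvature inequality
`curvature_bound`: the product error and the imbalance `PᵀP - QᵀQ` together dominate `σr δ`. (3) The
gradients have squared norm of order `σ₁` times these same two quantities, so the second-order term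
is absorbed once `η σ₁ ≤ 1 / 100`. The constraint sets are convex and contain the whole orbit of the
target, so projecting never increases the distance (`IsProj.frobSq_sub_le`). Applied to the very
first projection, this also gives the bound in terms of the unprojected start.

Initialization. The error `S - S₀` is `2 α`-sparse with entries at most twice the largest entry of
`L`, hence small in operator norm (`opBound_init_error`). Truncating the decomposition costs no more
than this because `L` has rank `r`, and the difference of two rank-`r` matrices has Frobenius norm
controlled by its operator norm. The truncated factors are exactly balanced, so `curvature_bound`
turns this into a bound on the distance.

The three regimes differ only in which row bound is used. Initialization needs `r (α ν κ)²` small,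
where `ν` bounds the scaled rows of `U` and `V`; contraction needs `α K` small against `σr`, where
`K` bounds the scaled rows of the factors. The constraint sets supply `K` in case (i); in the other
cases feature incoherence does so without any constraint. -/

/-- The Frobenius inner product. -/
def ip {m n : ℕ} (A B : Matrix (Fin m) (Fin n) ℝ) : ℝ := ∑ i, ∑ j, A i j * B i j

/-! ### Frobenius inner product and squared operator-norm bounds -/

section Frobenius

variable {m n k l : ℕ}

theorem ip_eq_trace (A B : Matrix (Fin m) (Fin n) ℝ) : ip A B = (Aᵀ * B).trace := by
  simp only [ip, Matrix.trace, Matrix.diag, Matrix.mul_apply, Matrix.transpose_apply]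
  exact Finset.sum_comm

theorem frobSq_eq_ip (A : Matrix (Fin m) (Fin n) ℝ) : frobSq A = ip A A := by
  simp only [frobSq, ip, sq]

theorem ip_comm (A B : Matrix (Fin m) (Fin n) ℝ) : ip A B = ip B A := by
  simp only [ip, mul_comm]

theorem ip_add_left (A B C : Matrix (Fin m) (Fin n) ℝ) : ip (A + B) C = ip A C + ip B C := by
  simp only [ip, Matrix.add_apply, add_mul, Finset.sum_add_distrib]

theorem ip_smul_left (t : ℝ) (A C : Matrix (Fin m) (Fin n) ℝ) : ip (t • A) C = t * ip A C := by
  simp only [ip, Matrix.smul_apply, smul_eq_mul, Finset.mul_sum, mul_assoc]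

theorem ip_neg_left (A C : Matrix (Fin m) (Fin n) ℝ) : ip (-A) C = -ip A C := by
  simp [ip]

theorem ip_sub_left (A B C : Matrix (Fin m) (Fin n) ℝ) : ip (A - B) C = ip A C - ip B C := by
  rw [sub_eq_add_neg, ip_add_left, ip_neg_left, sub_eq_add_neg]

theorem ip_add_right (A B C : Matrix (Fin m) (Fin n) ℝ) : ip A (B + C) = ip A B + ip A C := by
  rw [ip_comm, ip_add_left, ip_comm B, ip_comm C]

theorem ip_sub_right (A B C : Matrix (Fin m) (Fin n) ℝ) : ip A (B - C) = ip A B - ip A C := by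
  rw [ip_comm, ip_sub_left, ip_comm B, ip_comm C]

theorem ip_smul_right (t : ℝ) (A C : Matrix (Fin m) (Fin n) ℝ) : ip A (t • C) = t * ip A C := by
  rw [ip_comm, ip_smul_left, ip_comm]

theorem ip_neg_right (A C : Matrix (Fin m) (Fin n) ℝ) : ip A (-C) = -ip A C := by
  simp [ip]

theorem ip_transpose (A B : Matrix (Fin m) (Fin n) ℝ) : ip Aᵀ Bᵀ = ip A B := by
  simp only [ip, Matrix.transpose_apply]
  exact Finset.sum_comm

theorem frobSq_transpose (A : Matrix (Fin m) (Fin n) ℝ) : frobSq Aᵀ = frobSq A := by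
  rw [frobSq_eq_ip, ip_transpose, frobSq_eq_ip]

theorem ip_mul_left (A : Matrix (Fin m) (Fin n) ℝ) (B : Matrix (Fin n) (Fin k) ℝ)
    (C : Matrix (Fin m) (Fin k) ℝ) : ip (A * B) C = ip B (Aᵀ * C) := by
  rw [ip_eq_trace, ip_eq_trace, Matrix.transpose_mul, Matrix.mul_assoc]

theorem ip_mul_right (A : Matrix (Fin m) (Fin n) ℝ) (B : Matrix (Fin n) (Fin k) ℝ)
    (C : Matrix (Fin m) (Fin k) ℝ) : ip (A * B) C = ip A (C * Bᵀ) := by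
  rw [ip_eq_trace, ip_eq_trace, Matrix.transpose_mul, Matrix.mul_assoc, Matrix.trace_mul_comm,
    Matrix.mul_assoc]

theorem ip_mul_transpose (A : Matrix (Fin m) (Fin k) ℝ) (B : Matrix (Fin n) (Fin k) ℝ)
    (C : Matrix (Fin m) (Fin l) ℝ) (D : Matrix (Fin n) (Fin l) ℝ) :
    ip (A * Bᵀ) (C * Dᵀ) = ip (Aᵀ * C) (Bᵀ * D) := by
  rw [ip_mul_left, ← Matrix.mul_assoc, ip_comm, ip_mul_right, Matrix.transpose_transpose,
    ← ip_transpose]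

theorem frobSq_nonneg (A : Matrix (Fin m) (Fin n) ℝ) : 0 ≤ frobSq A :=
  Finset.sum_nonneg fun _ _ => Finset.sum_nonneg fun _ _ => sq_nonneg _

theorem frobSq_add (A B : Matrix (Fin m) (Fin n) ℝ) :
    frobSq (A + B) = frobSq A + 2 * ip A B + frobSq B := by
  simp only [frobSq_eq_ip, ip_add_left, ip_add_right, ip_comm B A]; ring

theorem frobSq_sub (A B : Matrix (Fin m) (Fin n) ℝ) :
    frobSq (A - B) = frobSq A - 2 * ip A B + frobSq B := by
  simp only [frobSq_eq_ip, ip_sub_left, ip_sub_right, ip_comm B A]; ring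

theorem frobSq_smul (t : ℝ) (A : Matrix (Fin m) (Fin n) ℝ) : frobSq (t • A) = t ^ 2 * frobSq A := by
  simp only [frobSq_eq_ip, ip_smul_left, ip_smul_right]; ring

theorem frobSq_neg (A : Matrix (Fin m) (Fin n) ℝ) : frobSq (-A) = frobSq A := by
  simp [frobSq]

theorem frobSq_eq_zero {A : Matrix (Fin m) (Fin n) ℝ} (h : frobSq A = 0) : A = 0 := by
  ext i j
  have h1 := (Finset.sum_eq_zero_iff_of_nonneg fun i _ =>
    Finset.sum_nonneg fun j _ => sq_nonneg (A i j)).1 h i (Finset.mem_univ i)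
  have h2 := (Finset.sum_eq_zero_iff_of_nonneg fun j _ => sq_nonneg (A i j)).1 h1 j
    (Finset.mem_univ j)
  simpa using h2

theorem two_mul_ip_le (A B : Matrix (Fin m) (Fin n) ℝ) {t : ℝ} (ht : 0 < t) :
    2 * |ip A B| ≤ t * frobSq A + frobSq B / t := by
  have key : ∀ C : Matrix (Fin m) (Fin n) ℝ, 2 * ip A C ≤ t * frobSq A + frobSq C / t := by
    intro C
    have h := frobSq_nonneg (t • A - C)
    rw [frobSq_sub, frobSq_smul, ip_smul_left] at h
    have : t * (2 * ip A C) ≤ t * (t * frobSq A + frobSq C / t) := by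
      rw [mul_add, mul_div_cancel₀ _ ht.ne']; nlinarith
    exact le_of_mul_le_mul_left this ht
  rcases abs_cases (ip A B) with h | h
  · rw [h.1]; exact key B
  · have := key (-B)
    rw [ip_neg_right, frobSq_neg] at this
    rw [h.1]; exact this

theorem ip_sq_le (A B : Matrix (Fin m) (Fin n) ℝ) : ip A B ^ 2 ≤ frobSq A * frobSq B := by
  have h : ∀ t : ℝ, 0 ≤ frobSq A * (t * t) + (2 * ip A B) * t + frobSq B := by
    intro t
    have := frobSq_nonneg (t • A + B)
    rw [frobSq_add, frobSq_smul, ip_smul_left] at this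
    nlinarith
  have := discrim_le_zero h
  rw [discrim] at this
  nlinarith

theorem frobSq_add_le_two (A B : Matrix (Fin m) (Fin n) ℝ) :
    frobSq (A + B) ≤ 2 * frobSq A + 2 * frobSq B := by
  have h := frobSq_nonneg (A - B)
  rw [frobSq_sub] at h; rw [frobSq_add]; linarith

theorem frobSq_add_le (A B : Matrix (Fin m) (Fin n) ℝ) :
    frobSq (A + B) ≤ 3 / 2 * frobSq A + 3 * frobSq B := by
  have h := two_mul_ip_le A B (t := 1 / 2) (by norm_num)
  have h2 := le_abs_self (ip A B)
  rw [frobSq_add]; linarith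

theorem frobSq_mul_le (A : Matrix (Fin m) (Fin n) ℝ) (B : Matrix (Fin n) (Fin k) ℝ) :
    frobSq (A * B) ≤ frobSq A * frobSq B := by
  have h : ∀ i j, (A * B) i j ^ 2 ≤ (∑ l, A i l ^ 2) * ∑ l, B l j ^ 2 := fun i j => by
    rw [Matrix.mul_apply]; exact Finset.sum_mul_sq_le_sq_mul_sq _ _ _
  calc frobSq (A * B) ≤ ∑ i, ∑ j, (∑ l, A i l ^ 2) * ∑ l, B l j ^ 2 :=
        Finset.sum_le_sum fun i _ => Finset.sum_le_sum fun j _ => h i j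
    _ = frobSq A * ∑ j, ∑ l, B l j ^ 2 := by
        rw [frobSq, Finset.sum_mul_sum]
    _ = frobSq A * frobSq B := by rw [Finset.sum_comm (f := fun j l => B l j ^ 2)]; rfl

theorem ip_single (A : Matrix (Fin m) (Fin n) ℝ) (i : Fin m) (j : Fin n) :
    ip A (Matrix.single i j 1) = A i j := by
  simp [ip, Matrix.single_apply, ite_and]

theorem frobSq_mul_of_orth {X : Matrix (Fin m) (Fin n) ℝ} (hX : Xᵀ * X = 1)
    (A : Matrix (Fin n) (Fin k) ℝ) : frobSq (X * A) = frobSq A := by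
  rw [frobSq_eq_ip, ip_mul_left, ← Matrix.mul_assoc, hX, Matrix.one_mul, frobSq_eq_ip]

theorem frobSq_mul_transpose_of_orth {X : Matrix (Fin m) (Fin n) ℝ} (hX : Xᵀ * X = 1)
    (A : Matrix (Fin k) (Fin n) ℝ) : frobSq (A * Xᵀ) = frobSq A := by
  rw [← frobSq_transpose, Matrix.transpose_mul, Matrix.transpose_transpose,
    frobSq_mul_of_orth hX, frobSq_transpose]

theorem frobSq_transpose_mul_le {X : Matrix (Fin m) (Fin n) ℝ} (hX : Xᵀ * X = 1)
    (A : Matrix (Fin m) (Fin k) ℝ) : frobSq (Xᵀ * A) ≤ frobSq A := by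
  have h := frobSq_nonneg (A - X * (Xᵀ * A))
  rw [frobSq_sub, frobSq_mul_of_orth hX, ip_comm, ip_mul_left, ← frobSq_eq_ip] at h
  linarith

theorem frobSq_of_orth {X : Matrix (Fin m) (Fin n) ℝ} (hX : Xᵀ * X = 1) : frobSq X = n := by
  rw [frobSq_eq_ip, ip_eq_trace, hX]; simp

theorem frobSq_mul_orthogonal (A : Matrix (Fin m) (Fin n) ℝ) (R : Matrix.orthogonalGroup (Fin n) ℝ) :
    frobSq (A * (R : Matrix (Fin n) (Fin n) ℝ)) = frobSq A := by
  have h : (R : Matrix (Fin n) (Fin n) ℝ) * (R : Matrix (Fin n) (Fin n) ℝ)ᵀ = 1 :=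
    (Matrix.mem_orthogonalGroup_iff (Fin n) ℝ).1 R.2
  rw [frobSq_eq_ip, ip_mul_right, Matrix.mul_assoc, h, Matrix.mul_one, frobSq_eq_ip]

/-- The squared Euclidean norm of a row. -/
def rowSq (A : Matrix (Fin m) (Fin n) ℝ) (i : Fin m) : ℝ := ∑ j, A i j ^ 2

theorem rowSq_nonneg (A : Matrix (Fin m) (Fin n) ℝ) (i : Fin m) : 0 ≤ rowSq A i :=
  Finset.sum_nonneg fun _ _ => sq_nonneg _

theorem sum_rowSq (A : Matrix (Fin m) (Fin n) ℝ) : ∑ i, rowSq A i = frobSq A := rfl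

theorem mul_transpose_apply_sq_le (A : Matrix (Fin m) (Fin k) ℝ) (B : Matrix (Fin n) (Fin k) ℝ)
    (i : Fin m) (j : Fin n) : (A * Bᵀ) i j ^ 2 ≤ rowSq A i * rowSq B j := by
  rw [Matrix.mul_apply]
  exact Finset.sum_mul_sq_le_sq_mul_sq _ _ _

/-- `c` bounds the square of the operator norm of `A`. -/
def OpBound (A : Matrix (Fin m) (Fin n) ℝ) (c : ℝ) : Prop :=
  ∀ (k : ℕ) (B : Matrix (Fin n) (Fin k) ℝ), frobSq (A * B) ≤ c * frobSq B

theorem OpBound.mono {A : Matrix (Fin m) (Fin n) ℝ} {c d : ℝ} (h : OpBound A c) (hcd : c ≤ d) :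
    OpBound A d := fun k B =>
  (h k B).trans (mul_le_mul_of_nonneg_right hcd (frobSq_nonneg B))

theorem opBound_of_vec {A : Matrix (Fin m) (Fin n) ℝ} {c : ℝ}
    (h : ∀ x : Fin n → ℝ, ∑ i, (∑ j, A i j * x j) ^ 2 ≤ c * ∑ j, x j ^ 2) : OpBound A c := by
  intro k B
  rw [frobSq, Finset.sum_comm, frobSq, Finset.sum_comm (f := fun i j => B i j ^ 2),
    Finset.mul_sum]
  exact Finset.sum_le_sum fun l _ => by simpa only [Matrix.mul_apply] using h fun j => B j l

theorem opBound_frobSq (A : Matrix (Fin m) (Fin n) ℝ) : OpBound A (frobSq A) :=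
  fun _ B => frobSq_mul_le A B

/-- By Cauchy–Schwarz, `‖AᵀB‖² = ⟨B, A(AᵀB)⟩ ≤ ‖B‖ ‖A(AᵀB)‖`; bound the last factor by hypothesis
and cancel `‖AᵀB‖`. -/
theorem OpBound.transpose {A : Matrix (Fin m) (Fin n) ℝ} {c : ℝ} (h : OpBound A c) (hc : 0 ≤ c) :
    OpBound Aᵀ c := by
  intro k B
  by_cases h0 : frobSq (Aᵀ * B) = 0
  · rw [h0]; exact mul_nonneg hc (frobSq_nonneg B)
  have hpos := lt_of_le_of_ne (frobSq_nonneg (Aᵀ * B)) (Ne.symm h0)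
  have h1 : ip B (A * (Aᵀ * B)) = frobSq (Aᵀ * B) := by
    rw [ip_comm, ip_mul_left, frobSq_eq_ip]
  have h2 := ip_sq_le B (A * (Aᵀ * B))
  have h3 := h k (Aᵀ * B)
  rw [h1] at h2
  have h4 := mul_le_mul_of_nonneg_left h3 (frobSq_nonneg B)
  refine le_of_mul_le_mul_right ?_ hpos
  nlinarith

theorem OpBound.mul_right {A : Matrix (Fin m) (Fin n) ℝ} {c : ℝ} (h : OpBound A c) (hc : 0 ≤ c)
    (B : Matrix (Fin k) (Fin m) ℝ) : frobSq (B * A) ≤ c * frobSq B := by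
  rw [← frobSq_transpose, Matrix.transpose_mul, ← frobSq_transpose B]
  exact h.transpose hc _ _

theorem OpBound.add {A B : Matrix (Fin m) (Fin n) ℝ} {c d : ℝ} (hA : OpBound A c)
    (hB : OpBound B d) : OpBound (A + B) (3 / 2 * c + 3 * d) := by
  intro k C
  rw [Matrix.add_mul]
  have := frobSq_add_le (A * C) (B * C)
  have h1 := hA k C
  have h2 := hB k C
  nlinarith

theorem OpBound.add_two {A B : Matrix (Fin m) (Fin n) ℝ} {c d : ℝ} (hA : OpBound A c)
    (hB : OpBound B d) : OpBound (A + B) (2 * c + 2 * d) := by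
  intro k C
  rw [Matrix.add_mul]
  have := frobSq_add_le_two (A * C) (B * C)
  have h1 := hA k C
  have h2 := hB k C
  nlinarith

theorem OpBound.neg {A : Matrix (Fin m) (Fin n) ℝ} {c : ℝ} (hA : OpBound A c) : OpBound (-A) c :=
  fun k C => by rw [Matrix.neg_mul, frobSq_neg]; exact hA k C

theorem OpBound.rowSq_mul_le {C : Matrix (Fin n) (Fin k) ℝ} {c : ℝ} (h : OpBound C c) (hc : 0 ≤ c)
    (X : Matrix (Fin m) (Fin n) ℝ) (i : Fin m) : rowSq (X * C) i ≤ c * rowSq X i := by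
  have := h.mul_right hc (Matrix.of fun (_ : Fin 1) j => X i j)
  simpa [frobSq, rowSq, Matrix.mul_apply] using this

theorem norm_toLp_sq (x : Fin n → ℝ) : ‖WithLp.toLp 2 x‖ ^ 2 = ∑ j, x j ^ 2 := by
  simp [EuclideanSpace.norm_sq_eq]

theorem opBound_specNorm (A : Matrix (Fin m) (Fin n) ℝ) : OpBound A (specNorm A ^ 2) := by
  refine opBound_of_vec fun x => ?_
  have h := (LinearMap.toContinuousLinearMap (Matrix.toEuclideanLin A)).le_opNorm (WithLp.toLp 2 x)
  have h2 := pow_le_pow_left₀ (norm_nonneg _) h 2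
  have h3 : ‖(LinearMap.toContinuousLinearMap (Matrix.toEuclideanLin A)) (WithLp.toLp 2 x)‖ ^ 2 =
      ∑ i, (∑ j, A i j * x j) ^ 2 := by
    simp [Matrix.toLpLin_toLp, norm_toLp_sq, Matrix.mulVec, dotProduct]
  rw [h3, mul_pow, norm_toLp_sq] at h2
  exact h2

theorem specNorm_nonneg (A : Matrix (Fin m) (Fin n) ℝ) : 0 ≤ specNorm A := norm_nonneg _

theorem OpBound.specNorm_sq_le {A : Matrix (Fin m) (Fin n) ℝ} {c : ℝ} (h : OpBound A c)
    (hc : 0 ≤ c) : specNorm A ^ 2 ≤ c := by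
  have : specNorm A ≤ Real.sqrt c := by
    refine ContinuousLinearMap.opNorm_le_bound _ (Real.sqrt_nonneg c) fun x => ?_
    refine le_of_sq_le_sq ?_ (by positivity)
    rw [mul_pow, Real.sq_sqrt hc]
    have h1 := h 1 (Matrix.of fun j _ => x j)
    simp only [frobSq, Matrix.mul_apply, Matrix.of_apply, Fin.sum_univ_one] at h1
    have h2 : ‖x‖ ^ 2 = ∑ j, x j ^ 2 := by simp [EuclideanSpace.norm_sq_eq]
    have h3 : ‖(LinearMap.toContinuousLinearMap (Matrix.toEuclideanLin A)) x‖ ^ 2 =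
      ∑ i, (∑ j, A i j * x j) ^ 2 := by
      simp [EuclideanSpace.norm_sq_eq, Matrix.mulVec, dotProduct]
    rw [h2, h3]; exact h1
  calc specNorm A ^ 2 ≤ Real.sqrt c ^ 2 := pow_le_pow_left₀ (specNorm_nonneg A) this 2
    _ = c := Real.sq_sqrt hc

theorem rowSq_le_twoInfNorm_sq (A : Matrix (Fin m) (Fin n) ℝ) (i : Fin m) :
    rowSq A i ≤ twoInfNorm A ^ 2 := by
  have h : Real.sqrt (rowSq A i) ≤ twoInfNorm A :=
    le_ciSup (f := fun i => Real.sqrt (rowSq A i)) (Set.finite_range _).bddAbove i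
  calc rowSq A i = Real.sqrt (rowSq A i) ^ 2 := (Real.sq_sqrt (rowSq_nonneg A i)).symm
    _ ≤ _ := pow_le_pow_left₀ (Real.sqrt_nonneg _) h 2

theorem twoInfNorm_le {A : Matrix (Fin m) (Fin n) ℝ} {b : ℝ} (hb : 0 ≤ b)
    (h : ∀ i, rowSq A i ≤ b ^ 2) : twoInfNorm A ≤ b :=
  Real.iSup_le (fun i => Real.sqrt_le_iff.2 ⟨hb, h i⟩) hb

end Frobenius

/-! ### Closed form of the gradients -/

section Gradient

theorem deriv_quartic_at_zero (a b c d e : ℝ) :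
    deriv (fun t : ℝ => a + t * b + t ^ 2 * c + t ^ 3 * d + t ^ 4 * e) 0 = b := by
  have h1 : HasDerivAt (fun t : ℝ => t) 1 (0 : ℝ) := hasDerivAt_id 0
  have h := ((((h1.mul_const b).const_add a).add ((h1.pow 2).mul_const c)).add
    ((h1.pow 3).mul_const d)).add ((h1.pow 4).mul_const e)
  exact h.deriv.trans (by simp)

variable {n₁ n₂ d₁ d₂ r : ℕ}

/-- Along a single coordinate direction the loss is a quartic polynomial in the step, so the partial
derivative is its linear coefficient, which is then rewritten as a pairing with the matrix unit. -/
theorem matGrad_loss_left (M S : Matrix (Fin n₁) (Fin n₂) ℝ) (X : Matrix (Fin n₁) (Fin d₁) ℝ)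
    (Y : Matrix (Fin n₂) (Fin d₂) ℝ) (P : Matrix (Fin d₁) (Fin r) ℝ)
    (Q : Matrix (Fin d₂) (Fin r) ℝ) :
    matGrad (fun A => loss M S X Y A Q) P =
      Xᵀ * ((X * P * Qᵀ * Yᵀ + S - M) * (Y * Q)) + (1 / 16 : ℝ) • (P * (Pᵀ * P - Qᵀ * Q)) := by
  ext i j
  set E : Matrix (Fin d₁) (Fin r) ℝ := Matrix.single i j 1 with hE
  set N := X * P * Qᵀ * Yᵀ + S - M with hN
  set W := Pᵀ * P - Qᵀ * Q with hW
  set N₁ := X * E * Qᵀ * Yᵀ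
  set W₁ := Eᵀ * P + Pᵀ * E
  set W₂ := Eᵀ * E
  have hWt : Wᵀ = W := by simp [hW]
  have hf : (fun t : ℝ => loss M S X Y (P + t • E) Q) = fun t : ℝ =>
      (1 / 2 * frobSq N + 1 / 64 * frobSq W) + t * (ip N N₁ + 1 / 32 * ip W W₁)
      + t ^ 2 * (1 / 2 * frobSq N₁ + 1 / 64 * frobSq W₁ + 1 / 32 * ip W W₂)
      + t ^ 3 * (1 / 32 * ip W₁ W₂) + t ^ 4 * (1 / 64 * frobSq W₂) := by
    funext t
    have e1 : X * (P + t • E) * Qᵀ * Yᵀ + S - M = N + t • N₁ := by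
      simp only [hN, N₁, Matrix.mul_add, Matrix.add_mul, Matrix.mul_smul, Matrix.smul_mul]; abel
    have e2 : (P + t • E)ᵀ * (P + t • E) - Qᵀ * Q = W + (t • W₁ + t ^ 2 • W₂) := by
      simp only [hW, W₁, W₂, Matrix.mul_add, Matrix.add_mul, Matrix.mul_smul, Matrix.smul_mul,
        Matrix.transpose_add, Matrix.transpose_smul, smul_add, smul_smul, sq]; abel
    rw [loss, e1, e2]
    simp only [frobSq_add, frobSq_smul, ip_smul_left, ip_smul_right, ip_add_right]
    ring
  have hd : matGrad (fun A => loss M S X Y A Q) P i j = ip N N₁ + 1 / 32 * ip W W₁ := by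
    simp only [matGrad, Matrix.of_apply]
    rw [← hE, hf, deriv_quartic_at_zero]
  rw [hd, ← ip_single (_ + _) i j, ← hE, ip_add_left, ip_smul_left]
  have h1 : ip N N₁ = ip (Xᵀ * (N * (Y * Q))) E := by
    rw [ip_mul_left, Matrix.transpose_transpose, ip_mul_right, Matrix.transpose_mul]
    simp only [N₁, Matrix.mul_assoc]
  have h2 : ip W (Pᵀ * E) = ip (P * W) E := by rw [ip_mul_left]
  have h3 : ip W (Eᵀ * P) = ip (P * W) E := by
    rw [← h2, ← ip_transpose, hWt, Matrix.transpose_mul, Matrix.transpose_transpose]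
  rw [h1, ip_add_right, h2, h3]; ring

theorem loss_swap (M S : Matrix (Fin n₁) (Fin n₂) ℝ) (X : Matrix (Fin n₁) (Fin d₁) ℝ)
    (Y : Matrix (Fin n₂) (Fin d₂) ℝ) (P : Matrix (Fin d₁) (Fin r) ℝ)
    (Q : Matrix (Fin d₂) (Fin r) ℝ) : loss M S X Y P Q = loss Mᵀ Sᵀ Y X Q P := by
  rw [loss, loss, ← frobSq_transpose (X * P * Qᵀ * Yᵀ + S - M), ← frobSq_neg (Pᵀ * P - Qᵀ * Q),
    neg_sub]
  simp [Matrix.mul_assoc]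

theorem matGrad_loss_right (M S : Matrix (Fin n₁) (Fin n₂) ℝ) (X : Matrix (Fin n₁) (Fin d₁) ℝ)
    (Y : Matrix (Fin n₂) (Fin d₂) ℝ) (P : Matrix (Fin d₁) (Fin r) ℝ)
    (Q : Matrix (Fin d₂) (Fin r) ℝ) :
    matGrad (fun B => loss M S X Y P B) Q =
      Yᵀ * ((X * P * Qᵀ * Yᵀ + S - M)ᵀ * (X * P)) - (1 / 16 : ℝ) • (Q * (Pᵀ * P - Qᵀ * Q)) := by
  simp only [loss_swap M S X Y P]
  rw [matGrad_loss_left, ← neg_sub (Qᵀ * Q), Matrix.mul_neg, smul_neg, sub_neg_eq_add]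
  simp [Matrix.mul_assoc]

end Gradient

/-! ### Projections onto convex sets -/

section Projection

variable {m n k : ℕ}

/-- Moving from the projection `B` towards `C` cannot decrease the distance to `A`, so the angle at
`B` is obtuse; expanding `‖A - C‖²` around `B` then gives the bound. -/
theorem IsProj.frobSq_sub_le {K : Set (Matrix (Fin m) (Fin n) ℝ)} (hK : Convex ℝ K)
    {A B C : Matrix (Fin m) (Fin n) ℝ} (h : IsProj K A B) (hC : C ∈ K) :
    frobSq (B - C) ≤ frobSq (A - C) := by
  have key : ∀ t : ℝ, 0 ≤ t → t ≤ 1 →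
      0 ≤ 2 * t * ip (B - A) (C - B) + t ^ 2 * frobSq (C - B) := by
    intro t h0 h1
    have h2 := h.2 _ (hK.add_smul_sub_mem h.1 hC ⟨h0, h1⟩)
    have e : B + t • (C - B) - A = (B - A) + t • (C - B) := by abel
    rw [e, frobSq_add, ip_smul_right, frobSq_smul] at h2
    linarith
  have hn : 0 ≤ ip (B - A) (C - B) := by
    by_contra! hneg
    set a := ip (B - A) (C - B)
    set f := frobSq (C - B)
    have hf : 0 ≤ f := frobSq_nonneg _
    have hs : 0 < f - a + 1 := by linarith
    -- This step lies in `[0, 1]` and is short enough for the linear term, negative by assumption,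
    -- to outweigh the quadratic one.
    have h3 := key (-a / (f - a + 1)) (div_nonneg (by linarith) hs.le)
      ((div_le_one hs).2 (by linarith))
    have h4 : 2 * (-a / (f - a + 1)) * a + (-a / (f - a + 1)) ^ 2 * f
        = a ^ 2 * (f - 2 * (f - a + 1)) / (f - a + 1) ^ 2 := by field_simp; ring
    rw [h4] at h3
    have : a ^ 2 * (f - 2 * (f - a + 1)) / (f - a + 1) ^ 2 < 0 := by
      apply div_neg_of_neg_of_pos _ (by positivity)
      nlinarith [sq_pos_of_neg hneg]
    linarith
  have e : A - C = (B - C) - (B - A) := by abel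
  rw [e, frobSq_sub (B - C), ip_comm]
  have e2 : ip (B - A) (B - C) = -ip (B - A) (C - B) := by rw [← ip_neg_right, neg_sub]
  rw [e2]
  have := frobSq_nonneg (B - A)
  linarith

theorem rowSq_of_twoInfNorm_le {A : Matrix (Fin m) (Fin n) ℝ} {b : ℝ} (h : twoInfNorm A ≤ b)
    (i : Fin m) : rowSq A i ≤ b ^ 2 := by
  have h0 : 0 ≤ twoInfNorm A := Real.iSup_nonneg fun _ => Real.sqrt_nonneg _
  exact (rowSq_le_twoInfNorm_sq A i).trans (pow_le_pow_left₀ h0 h 2)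

theorem convex_twoInfNorm_le (X : Matrix (Fin m) (Fin n) ℝ) {b : ℝ} (hb : 0 ≤ b) :
    Convex ℝ {A : Matrix (Fin n) (Fin k) ℝ | twoInfNorm (X * A) ≤ b} := by
  intro A hA B hB s t hs ht hst
  refine twoInfNorm_le hb fun i => ?_
  have h1 := rowSq_of_twoInfNorm_le hA i
  have h2 := rowSq_of_twoInfNorm_le hB i
  have h3 : rowSq (X * (s • A + t • B)) i ≤ s * rowSq (X * A) i + t * rowSq (X * B) i := by
    simp only [rowSq, Finset.mul_sum, ← Finset.sum_add_distrib]
    refine Finset.sum_le_sum fun j _ => ?_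
    rw [Matrix.mul_add, Matrix.mul_smul, Matrix.mul_smul]
    simp only [Matrix.add_apply, Matrix.smul_apply, smul_eq_mul]
    obtain rfl : t = 1 - s := by linarith
    nlinarith [mul_nonneg (mul_nonneg hs ht) (sq_nonneg ((X * A) i j - (X * B) i j))]
  have h4 : s * b ^ 2 + t * b ^ 2 = b ^ 2 := by rw [← add_mul, hst, one_mul]
  nlinarith

end Projection

/-! ### The optimal rotation -/

section Procrustes

variable {m n r : ℕ}

theorem isCompact_orthogonalGroup :
    IsCompact (Matrix.orthogonalGroup (Fin r) ℝ : Set (Matrix (Fin r) (Fin r) ℝ)) := by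
  have hc : IsCompact (Set.univ.pi fun _ : Fin r => Set.univ.pi fun _ : Fin r =>
      Set.Icc (-1 : ℝ) 1) := isCompact_univ_pi fun _ => isCompact_univ_pi fun _ => isCompact_Icc
  refine hc.of_isClosed_subset ?_ ?_
  · have : (Matrix.orthogonalGroup (Fin r) ℝ : Set (Matrix (Fin r) (Fin r) ℝ)) =
        {A | A * star A = 1} := by
      ext A; exact Matrix.mem_orthogonalGroup_iff (Fin r) ℝ
    rw [this]
    exact isClosed_eq (by fun_prop) continuous_const
  · intro A hA i _ j _
    have := entry_norm_bound_of_unitary hA i j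
    rw [Real.norm_eq_abs] at this
    exact abs_le.1 this

theorem bddBelow_pairDist (A : Matrix (Fin m) (Fin r) ℝ) (B : Matrix (Fin n) (Fin r) ℝ)
    (A' : Matrix (Fin m) (Fin r) ℝ) (B' : Matrix (Fin n) (Fin r) ℝ) :
    BddBelow (Set.range fun R : Matrix.orthogonalGroup (Fin r) ℝ =>
      Real.sqrt (frobSq (A - A' * (R : Matrix (Fin r) (Fin r) ℝ)) +
        frobSq (B - B' * (R : Matrix (Fin r) (Fin r) ℝ)))) :=
  ⟨0, by rintro _ ⟨R, rfl⟩; exact Real.sqrt_nonneg _⟩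

theorem pairDist_sq_le (A : Matrix (Fin m) (Fin r) ℝ) (B : Matrix (Fin n) (Fin r) ℝ)
    (A' : Matrix (Fin m) (Fin r) ℝ) (B' : Matrix (Fin n) (Fin r) ℝ)
    (R : Matrix.orthogonalGroup (Fin r) ℝ) :
    pairDist A B A' B' ^ 2 ≤ frobSq (A - A' * (R : Matrix (Fin r) (Fin r) ℝ)) +
      frobSq (B - B' * (R : Matrix (Fin r) (Fin r) ℝ)) := by
  have h := ciInf_le (bddBelow_pairDist A B A' B') R
  have h0 : 0 ≤ pairDist A B A' B' := Real.iInf_nonneg fun _ => Real.sqrt_nonneg _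
  refine (pow_le_pow_left₀ h0 h 2).trans ?_
  rw [Real.sq_sqrt (add_nonneg (frobSq_nonneg _) (frobSq_nonneg _))]

/-- Maximality of the trace is tested against two families of orthogonal matrices: rotations in a
coordinate plane force symmetry to first order, and Householder reflections force `xKxᵀ ≥ 0`. -/
theorem trace_maximal_symm_psd (K : Matrix (Fin r) (Fin r) ℝ)
    (hK : ∀ Q : Matrix (Fin r) (Fin r) ℝ, Qᵀ * Q = 1 → ip K Q ≤ ip K 1) :
    Kᵀ = K ∧ ∀ x : Matrix (Fin 1) (Fin r) ℝ, 0 ≤ ip x (x * K) := by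
  constructor
  · ext i j
    rw [Matrix.transpose_apply]
    by_cases hij : i = j
    · rw [hij]
    set J : Matrix (Fin r) (Fin r) ℝ := Matrix.single j i 1 - Matrix.single i j 1 with hJ
    have hJt : Jᵀ = -J := by simp [hJ]
    have hJ3 : J * J * J = -J := by
      simp [hJ, Matrix.mul_sub, Matrix.sub_mul, Matrix.single_mul_single_of_ne, hij, Ne.symm hij]
      abel
    set a := ip K J
    set b := ip K (J * J)
    have key : ∀ t : ℝ, t * a + t ^ 2 * b ≤ 0 := by
      intro t
      have ht : (1 + t ^ 2) ≠ 0 := by positivity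
      -- The rotation in the `(i, j)` plane, written rationally: the coefficients are `sin θ` and `1
      -- - cos θ` with `t = tan (θ / 2)`, and orthogonality follows from `J³ = -J`.
      have h := hK (1 + ((2 * t / (1 + t ^ 2)) • J + (2 * t ^ 2 / (1 + t ^ 2)) • (J * J))) (by
        set s := 2 * t / (1 + t ^ 2)
        set c := 2 * t ^ 2 / (1 + t ^ 2)
        have hsc : 2 * c - c ^ 2 - s ^ 2 = 0 := by simp only [s, c]; field_simp; ring
        have hJ3' : J * (J * J) = -J := by rw [← Matrix.mul_assoc, hJ3]
        simp only [Matrix.transpose_add, Matrix.transpose_smul, Matrix.transpose_mul, hJt,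
          Matrix.transpose_one, Matrix.mul_add, Matrix.add_mul, Matrix.mul_one, Matrix.one_mul,
          Matrix.smul_mul, Matrix.mul_smul, Matrix.neg_mul, Matrix.mul_neg, neg_neg,
          Matrix.mul_assoc, hJ3']
        have : (1 : Matrix (Fin r) (Fin r) ℝ) = 1 + (2 * c - c ^ 2 - s ^ 2) • (J * J) := by
          rw [hsc, zero_smul, add_zero]
        conv_rhs => rw [this]
        module)
      rw [ip_add_right, ip_add_right, ip_smul_right, ip_smul_right] at h
      have h2 : 2 * t / (1 + t ^ 2) * a + 2 * t ^ 2 / (1 + t ^ 2) * b ≤ 0 := by linarith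
      have h3 : 2 * t / (1 + t ^ 2) * a + 2 * t ^ 2 / (1 + t ^ 2) * b =
          2 * (t * a + t ^ 2 * b) / (1 + t ^ 2) := by ring
      rw [h3] at h2
      by_contra! hpos
      have : 0 < 2 * (t * a + t ^ 2 * b) / (1 + t ^ 2) := by positivity
      linarith
    have ha : a = 0 := by
      by_contra ha
      have hb : 0 < |b| + 1 := by positivity
      -- A small step with the sign of `a` makes the linear term win unless `a = 0`.
      have h := key (a / (|b| + 1))
      have h2 : a / (|b| + 1) * a + (a / (|b| + 1)) ^ 2 * b =
          a ^ 2 * (|b| + 1 + b) / (|b| + 1) ^ 2 := by field_simp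
      rw [h2] at h
      have h3 : 0 < |b| + 1 + b := by linarith [neg_abs_le b]
      have : 0 < a ^ 2 * (|b| + 1 + b) / (|b| + 1) ^ 2 := by positivity
      linarith
    simp only [a, hJ, ip_sub_right, ip_single] at ha
    linarith
  · intro x
    by_cases hx : frobSq x = 0
    · rw [frobSq_eq_zero hx]; simp [ip]
    have hpos : 0 < frobSq x := lt_of_le_of_ne (frobSq_nonneg x) (Ne.symm hx)
    have hxx : x * xᵀ = frobSq x • (1 : Matrix (Fin 1) (Fin 1) ℝ) := by
      ext i j
      simp [Matrix.mul_apply, frobSq, Fin.fin_one_eq_zero, sq]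
    have hxx4 : xᵀ * x * (xᵀ * x) = frobSq x • (xᵀ * x) := by
      rw [Matrix.mul_assoc, ← Matrix.mul_assoc x, hxx, Matrix.smul_mul, Matrix.one_mul,
        Matrix.mul_smul]
    -- The reflection in the hyperplane orthogonal to `x`.
    have h := hK (1 - (2 / frobSq x) • (xᵀ * x)) (by
      simp only [Matrix.transpose_sub, Matrix.transpose_one, Matrix.transpose_smul,
        Matrix.transpose_mul, Matrix.transpose_transpose, Matrix.mul_sub, Matrix.sub_mul,
        Matrix.mul_one, Matrix.one_mul, Matrix.smul_mul, Matrix.mul_smul, hxx4, smul_smul]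
      rw [div_mul_cancel₀ _ hx]; module)
    rw [ip_sub_right, ip_smul_right] at h
    have h2 : ip K (xᵀ * x) = ip x (x * K) := by
      rw [ip_comm, ip_mul_left, Matrix.transpose_transpose]
    rw [h2] at h
    have h3 : 0 < 2 / frobSq x := by positivity
    by_contra! hneg
    nlinarith

/-- Compactness gives a minimiser `R`. Rotations preserve the norms of the targets, so minimising
the distance is maximising a trace, and comparing `R` with `R * Q` puts the cross-Gram matrix under
`trace_maximal_symm_psd`. -/
theorem exists_procrustes (A : Matrix (Fin m) (Fin r) ℝ) (B : Matrix (Fin n) (Fin r) ℝ)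
    (A' : Matrix (Fin m) (Fin r) ℝ) (B' : Matrix (Fin n) (Fin r) ℝ) :
    ∃ R : Matrix.orthogonalGroup (Fin r) ℝ,
      pairDist A B A' B' ^ 2 = frobSq (A - A' * (R : Matrix (Fin r) (Fin r) ℝ)) +
        frobSq (B - B' * (R : Matrix (Fin r) (Fin r) ℝ)) ∧
      ((A' * (R : Matrix (Fin r) (Fin r) ℝ))ᵀ * A + (B' * (R : Matrix (Fin r) (Fin r) ℝ))ᵀ * B)ᵀ =
        (A' * (R : Matrix (Fin r) (Fin r) ℝ))ᵀ * A + (B' * (R : Matrix (Fin r) (Fin r) ℝ))ᵀ * B ∧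
      ∀ x : Matrix (Fin 1) (Fin r) ℝ, 0 ≤ ip x (x * ((A' * (R : Matrix (Fin r) (Fin r) ℝ))ᵀ * A +
        (B' * (R : Matrix (Fin r) (Fin r) ℝ))ᵀ * B)) := by
  obtain ⟨R, hR, hmin⟩ := isCompact_orthogonalGroup.exists_isMinOn ⟨1, one_mem _⟩
    (f := fun R : Matrix (Fin r) (Fin r) ℝ => frobSq (A - A' * R) + frobSq (B - B' * R))
    (by unfold frobSq; fun_prop)
  have hle : ∀ O ∈ Matrix.orthogonalGroup (Fin r) ℝ,
      frobSq (A - A' * R) + frobSq (B - B' * R) ≤ frobSq (A - A' * O) + frobSq (B - B' * O) :=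
    fun O hO => hmin hO
  refine ⟨⟨R, hR⟩, le_antisymm (pairDist_sq_le A B A' B' ⟨R, hR⟩) ?_, ?_⟩
  · have : Real.sqrt (frobSq (A - A' * R) + frobSq (B - B' * R)) ≤ pairDist A B A' B' :=
      le_ciInf fun O => Real.sqrt_le_sqrt (hle O O.2)
    exact (Real.sqrt_le_left (Real.iInf_nonneg fun _ => Real.sqrt_nonneg _)).1 this
  · refine trace_maximal_symm_psd _ fun Q hQ => ?_
    have hQm : Q ∈ Matrix.orthogonalGroup (Fin r) ℝ := (Matrix.mem_orthogonalGroup_iff' _ _).2 hQ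
    have h := hle (R * Q) (mul_mem hR hQm)
    have hA := frobSq_mul_orthogonal A' ⟨R, hR⟩
    have hB := frobSq_mul_orthogonal B' ⟨R, hR⟩
    have hA' := frobSq_mul_orthogonal A' ⟨R * Q, mul_mem hR hQm⟩
    have hB' := frobSq_mul_orthogonal B' ⟨R * Q, mul_mem hR hQm⟩
    simp only at hA hB hA' hB'
    rw [frobSq_sub, frobSq_sub, frobSq_sub, frobSq_sub, hA, hB, hA', hB'] at h
    rw [ip_add_left, ip_add_left, ip_mul_left, ip_mul_left, ip_mul_left, ip_mul_left]
    simp only [Matrix.transpose_transpose, Matrix.mul_one, Matrix.mul_assoc]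
    linarith

end Procrustes

/-! ### The curvature inequality -/

section Curvature

variable {m n r : ℕ}

theorem ip_gram_nonneg {k : ℕ} {K : Matrix (Fin r) (Fin r) ℝ}
    (hK : ∀ x : Matrix (Fin 1) (Fin r) ℝ, 0 ≤ ip x (x * K)) (D : Matrix (Fin k) (Fin r) ℝ) :
    0 ≤ ip (Dᵀ * D) K := by
  rw [ip_mul_left, Matrix.transpose_transpose]
  refine Finset.sum_nonneg fun i _ => ?_
  simpa [ip, Matrix.mul_apply] using hK (Matrix.of fun _ j => D i j)

/-- Everything is expressed in `r × r` Gram matrices. Let `g` be the common Gram matrix of the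
targets, `K = p + q` the cross-Gram matrix and `F` the Gram matrix of the differences, so that `AᵀA
+ BᵀB = F + 2K - 2g` by symmetry of `K`. The right side equals `‖AᵀA + BᵀB‖² - 8⟨p, q⟩ + 4‖g‖²`,
hence is at least `‖F‖² + 4⟨F, K⟩ - 4⟨F, g⟩ + 2‖K - 2g‖²`. Completing a square leaves `8/5 ⟨F, g⟩`
plus non-negative terms, one of which is a multiple of `⟨F, K⟩ ≥ 0`. -/
theorem curvature_bound (A A' : Matrix (Fin m) (Fin r) ℝ) (B B' : Matrix (Fin n) (Fin r) ℝ)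
    {σ : ℝ} (hbal : A'ᵀ * A' = B'ᵀ * B')
    (hA : ∀ (k : ℕ) (C : Matrix (Fin k) (Fin r) ℝ), σ * frobSq C ≤ frobSq (C * A'ᵀ))
    (hsymm : (A'ᵀ * A + B'ᵀ * B)ᵀ = A'ᵀ * A + B'ᵀ * B)
    (hpsd : ∀ x : Matrix (Fin 1) (Fin r) ℝ, 0 ≤ ip x (x * (A'ᵀ * A + B'ᵀ * B))) :
    8 / 5 * σ * (frobSq (A - A') + frobSq (B - B')) ≤
      4 * frobSq (A * Bᵀ - A' * B'ᵀ) + frobSq (Aᵀ * A - Bᵀ * B) := by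
  set p := A'ᵀ * A with hp
  set q := B'ᵀ * B with hq
  set g := A'ᵀ * A' with hg
  set a := Aᵀ * A with ha
  set b := Bᵀ * B with hb
  set K := p + q with hK
  set F := (A - A')ᵀ * (A - A') + (B - B')ᵀ * (B - B') with hF
  have hFe : a + b = F + (2 : ℝ) • K - (2 : ℝ) • g := by
    have : (2 : ℝ) • K = K + Kᵀ := by rw [hsymm]; module
    rw [this]
    simp only [hF, hK, hp, hq, ha, hb, hg, Matrix.transpose_sub, Matrix.sub_mul, Matrix.mul_sub,
      Matrix.transpose_add, Matrix.transpose_mul, Matrix.transpose_transpose, two_smul]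
    rw [show B'ᵀ * B' = A'ᵀ * A' from hbal.symm]; abel
  have hH : frobSq (A * Bᵀ - A' * B'ᵀ) = ip a b - 2 * ip p q + ip g g := by
    have e : ip (Aᵀ * A') (Bᵀ * B') = ip p q := by rw [← ip_transpose]; simp [hp, hq]
    rw [frobSq_sub, frobSq_eq_ip, frobSq_eq_ip, ip_mul_transpose, ip_mul_transpose,
      ip_mul_transpose, e, ← hbal]
  have hW : frobSq (a - b) = ip a a - 2 * ip a b + ip b b := by
    rw [frobSq_sub, frobSq_eq_ip, frobSq_eq_ip]
  have h1 : ip (a + b) (a + b) = ip a a + 2 * ip a b + ip b b := by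
    simp only [ip_add_left, ip_add_right, ip_comm b a]; ring
  have h2 : 8 * ip p q ≤ 2 * ip K K := by
    have := frobSq_nonneg (p - q)
    rw [frobSq_sub, frobSq_eq_ip, frobSq_eq_ip] at this
    simp only [hK, ip_add_left, ip_add_right, ip_comm q p]; linarith
  have hFK : 0 ≤ ip F K := by
    rw [hF, ip_add_left]
    exact add_nonneg (ip_gram_nonneg hpsd _) (ip_gram_nonneg hpsd _)
  have hgF : σ * (frobSq (A - A') + frobSq (B - B')) ≤ ip F g := by
    have h := hA _ (A - A')
    have h' := hA _ (B - B')
    have e : ∀ {k : ℕ} (C : Matrix (Fin k) (Fin r) ℝ), frobSq (C * A'ᵀ) = ip (Cᵀ * C) g := by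
      intro k C; rw [frobSq_eq_ip, ip_mul_transpose]
    rw [e] at h h'
    rw [hF, ip_add_left]; linarith
  -- The coefficient `7/5` is admissible because `(7/5)² = 49/25 ≤ 2`; what remains is `6/5 ⟨F, K⟩ +
  -- 8/5 ⟨F, g⟩ + 1/25 ‖K - 2g‖²`.
  have hsq := frobSq_nonneg (F + (7 / 5 : ℝ) • (K - (2 : ℝ) • g))
  have hsq2 := frobSq_nonneg (K - (2 : ℝ) • g)
  rw [hFe] at h1
  simp only [frobSq_eq_ip, ip_add_left, ip_add_right, ip_sub_left, ip_sub_right, ip_smul_left,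
    ip_smul_right, ip_comm K F, ip_comm g F, ip_comm g K] at hsq hsq2 h1
  rw [hH, hW]
  nlinarith

end Curvature

/-! ### Sparse supports and hard thresholding -/

section Thresholding

variable {m n : ℕ}

theorem IsTopFraction.card_eq_floor {θ : ℝ} {a : Fin n → ℝ} {T : Finset (Fin n)}
    (h : IsTopFraction θ a T) {j : Fin n} (hj : j ∉ T) : T.card = ⌊θ * n⌋₊ := by
  have h1 : T.card < n := by
    have := Finset.card_lt_univ_of_notMem hj
    simpa using this
  have h2 := h.1
  omega

/-- If every entry outside `s` were smaller than `a j`, all of `T` would lie in `s`; as `T` has at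
least as many elements, `T = s` would contain `j`. -/
theorem IsTopFraction.exists_notMem_abs_le {θ : ℝ} {a : Fin n → ℝ} {T s : Finset (Fin n)}
    (h : IsTopFraction θ a T) {j : Fin n} (hj : j ∉ T) (hjs : j ∈ s) (hs : (s.card : ℝ) ≤ θ * n) :
    ∃ k ∉ s, |a j| ≤ |a k| := by
  have h1 : s.card ≤ T.card := by rw [h.card_eq_floor hj]; exact Nat.le_floor hs
  by_contra! hcon
  have hsub : T ⊆ s := fun k hk => by
    by_contra hks
    exact absurd (h.2 k hk j hj) (not_le.2 (hcon k hks))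
  exact hj (Finset.eq_of_subset_of_card_le hsub h1 ▸ hjs)

/-- An omitted entry is dominated by all kept ones, and at least `10 ⌊α n⌋` of the kept ones lie
outside `s`. -/
theorem IsTopFraction.sq_le_sum {α : ℝ} {a : Fin n → ℝ} {T s : Finset (Fin n)}
    (hα : 0 ≤ α) (h : IsTopFraction (11 * α) a T) {j : Fin n} (hj : j ∉ T)
    (hs : (s.card : ℝ) ≤ α * n) :
    10 * (⌊α * n⌋₊ : ℝ) * a j ^ 2 ≤ ∑ k ∈ sᶜ, a k ^ 2 := by
  have hs' : s.card ≤ ⌊α * n⌋₊ := Nat.le_floor hs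
  have hT : 11 * ⌊α * n⌋₊ ≤ T.card := by
    rw [h.card_eq_floor hj]
    apply Nat.le_floor
    have := Nat.floor_le (a := α * n) (by positivity)
    push_cast; nlinarith
  have hc : 10 * ⌊α * n⌋₊ ≤ (T \ s).card := by
    have := Finset.le_card_sdiff s T
    omega
  calc 10 * (⌊α * n⌋₊ : ℝ) * a j ^ 2 ≤ ((T \ s).card : ℝ) * a j ^ 2 :=
        mul_le_mul_of_nonneg_right (by exact_mod_cast hc) (sq_nonneg _)
    _ = ∑ _k ∈ T \ s, a j ^ 2 := by rw [Finset.sum_const, nsmul_eq_mul]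
    _ ≤ ∑ k ∈ T \ s, a k ^ 2 := Finset.sum_le_sum fun k hk =>
        sq_le_sq.2 (h.2 k (Finset.mem_sdiff.1 hk).1 j hj)
    _ ≤ ∑ k ∈ sᶜ, a k ^ 2 := Finset.sum_le_sum_of_subset_of_nonneg
        (fun k hk => Finset.mem_compl.2 (Finset.mem_sdiff.1 hk).2) fun _ _ _ => sq_nonneg _

open Classical in
/-- The relation `p` holds for at most an `α`-fraction of each row and each column. -/
def IsSparse (p : Fin m → Fin n → Prop) (α : ℝ) : Prop :=
  (∀ i, ((Finset.univ.filter fun j => p i j).card : ℝ) ≤ α * n) ∧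
    ∀ j, ((Finset.univ.filter fun i => p i j).card : ℝ) ≤ α * m

theorem IsSparse.swap {p : Fin m → Fin n → Prop} {α : ℝ} (h : IsSparse p α) :
    IsSparse (fun j i => p i j) α := ⟨h.2, h.1⟩

theorem IsSparse.or {p q : Fin m → Fin n → Prop} {α β : ℝ} (hp : IsSparse p α)
    (hq : IsSparse q β) : IsSparse (fun i j => p i j ∨ q i j) (α + β) := by
  classical
  constructor
  · intro i
    have h1 := hp.1 i
    have h2 := hq.1 i
    simp only [Finset.filter_or]
    have h3 := Finset.card_union_le (Finset.univ.filter fun j => p i j)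
      (Finset.univ.filter fun j => q i j)
    have h4 : ((Finset.univ.filter (fun j => p i j) ∪ Finset.univ.filter fun j => q i j).card : ℝ)
      ≤ (Finset.univ.filter fun j => p i j).card + (Finset.univ.filter fun j => q i j).card := by
      exact_mod_cast h3
    rw [add_mul]
    linarith
  · intro j
    have h1 := hp.2 j
    have h2 := hq.2 j
    simp only [Finset.filter_or]
    have h3 := Finset.card_union_le (Finset.univ.filter fun i => p i j)
      (Finset.univ.filter fun i => q i j)
    have h4 : ((Finset.univ.filter (fun i => p i j) ∪ Finset.univ.filter fun i => q i j).card : ℝ)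
      ≤ (Finset.univ.filter fun i => p i j).card + (Finset.univ.filter fun i => q i j).card := by
      exact_mod_cast h3
    rw [add_mul]
    linarith

theorem IsTopFraction.card_le {θ : ℝ} (hθ : 0 ≤ θ) {a : Fin n → ℝ} {T : Finset (Fin n)}
    (h : IsTopFraction θ a T) : (T.card : ℝ) ≤ θ * n := by
  have h1 : T.card ≤ ⌊θ * n⌋₊ := h.1.trans_le (min_le_left _ _)
  exact (Nat.cast_le.2 h1).trans (Nat.floor_le (by positivity))

theorem isSparse_kept {θ : ℝ} (hθ : 0 ≤ θ) {A : Matrix (Fin m) (Fin n) ℝ}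
    {row : Fin m → Finset (Fin n)} {col : Fin n → Finset (Fin m)}
    (hrow : ∀ i, IsTopFraction θ (fun j => A i j) (row i))
    (hcol : ∀ j, IsTopFraction θ (fun i => A i j) (col j)) :
    IsSparse (fun i j => j ∈ row i ∧ i ∈ col j) θ := by
  classical
  constructor
  · intro i
    refine le_trans ?_ ((hrow i).card_le hθ)
    refine Nat.cast_le.2 (Finset.card_le_card fun j hj => ?_)
    simp only [Finset.mem_filter] at hj
    exact hj.2.1
  · intro j
    refine le_trans ?_ ((hcol j).card_le hθ)
    refine Nat.cast_le.2 (Finset.card_le_card fun i hi => ?_)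
    simp only [Finset.mem_filter] at hi
    exact hi.2.2

open Classical in
theorem IsSparse.sum_le {p : Fin m → Fin n → Prop} {α K : ℝ} (h : IsSparse p α) (hn : 0 < n)
    {f : Fin m → ℝ} {g : Fin n → ℝ} (hf : ∀ i, 0 ≤ f i) (hg0 : ∀ j, 0 ≤ g j)
    (hg : ∀ j, g j * n ≤ K) :
    ∑ i, ∑ j, (if p i j then f i * g j else 0) ≤ α * K * ∑ i, f i := by
  have hn' : (0 : ℝ) < n := by exact_mod_cast hn
  have hK : 0 ≤ K := le_trans (mul_nonneg (hg0 ⟨0, hn⟩) hn'.le) (hg ⟨0, hn⟩)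
  rw [Finset.mul_sum]
  refine Finset.sum_le_sum fun i _ => ?_
  rw [← Finset.sum_filter]
  calc ∑ j ∈ Finset.univ.filter (fun j => p i j), f i * g j
      ≤ ∑ _j ∈ Finset.univ.filter (fun j => p i j), f i * (K / n) :=
        Finset.sum_le_sum fun j _ =>
          mul_le_mul_of_nonneg_left ((le_div_iff₀ hn').2 (hg j)) (hf i)
    _ = (Finset.univ.filter fun j => p i j).card * (f i * (K / n)) := by
        rw [Finset.sum_const, nsmul_eq_mul]
    _ ≤ (α * n) * (f i * (K / n)) :=
        mul_le_mul_of_nonneg_right (h.1 i) (mul_nonneg (hf i) (div_nonneg hK hn'.le))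
    _ = α * K * f i := by field_simp

open Classical in
theorem IsSparse.sum_le' {p : Fin m → Fin n → Prop} {α K : ℝ} (h : IsSparse p α) (hm : 0 < m)
    {f : Fin m → ℝ} {g : Fin n → ℝ} (hf0 : ∀ i, 0 ≤ f i) (hg : ∀ j, 0 ≤ g j)
    (hf : ∀ i, f i * m ≤ K) :
    ∑ i, ∑ j, (if p i j then f i * g j else 0) ≤ α * K * ∑ j, g j := by
  rw [Finset.sum_comm]
  simp only [mul_comm (f _)]
  exact h.swap.sum_le hm hg hf0 hf

/-- Cauchy–Schwarz in each row uses the row count, and summing over the rows uses the column count;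
each contributes one factor `α`. -/
theorem IsSparse.opBound {p : Fin m → Fin n → Prop} {α c : ℝ} (h : IsSparse p α)
    (hα : 0 ≤ α) (hc : 0 ≤ c) {E : Matrix (Fin m) (Fin n) ℝ} (h0 : ∀ i j, ¬p i j → E i j = 0)
    (hE : ∀ i j, E i j ^ 2 ≤ c) : OpBound E (α ^ 2 * (c * m * n)) := by
  classical
  refine opBound_of_vec fun x => ?_
  have hrow : ∀ i, (∑ j, E i j * x j) ^ 2 ≤
      α * n * c * ∑ j, (if p i j then x j ^ 2 else 0) := by
    intro i
    have e : ∑ j, E i j * x j = ∑ j ∈ Finset.univ.filter (fun j => p i j), E i j * x j := by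
      rw [Finset.sum_filter]
      refine Finset.sum_congr rfl fun j _ => ?_
      by_cases hp : p i j
      · simp [hp]
      · simp [hp, h0 i j hp]
    rw [e, ← Finset.sum_filter]
    refine (Finset.sum_mul_sq_le_sq_mul_sq _ _ _).trans ?_
    refine mul_le_mul_of_nonneg_right ?_ (Finset.sum_nonneg fun _ _ => sq_nonneg _)
    calc _ ≤ ∑ _j ∈ Finset.univ.filter (fun j => p i j), c := Finset.sum_le_sum fun j _ => hE i j
      _ = (Finset.univ.filter fun j => p i j).card * c := by rw [Finset.sum_const, nsmul_eq_mul]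
      _ ≤ α * n * c := mul_le_mul_of_nonneg_right (h.1 i) hc
  calc _ ≤ ∑ i, α * n * c * ∑ j, (if p i j then x j ^ 2 else 0) :=
        Finset.sum_le_sum fun i _ => hrow i
    _ = α * n * c * ∑ j, ((Finset.univ.filter fun i => p i j).card : ℝ) * x j ^ 2 := by
        rw [← Finset.mul_sum, Finset.sum_comm]
        simp only [← Finset.sum_filter, Finset.sum_const, nsmul_eq_mul]
    _ ≤ α * n * c * ∑ j, α * m * x j ^ 2 := by
        refine mul_le_mul_of_nonneg_left (Finset.sum_le_sum fun j _ =>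
          mul_le_mul_of_nonneg_right (h.2 j) (sq_nonneg _)) (by positivity)
    _ = _ := by rw [← Finset.mul_sum]; ring

/-- A kept entry leaves the error `-L i j`. A corrupted entry that is not kept is dominated by some
uncorrupted entry of its row or column, which is an entry of `L`. Either way the error is at most
twice the largest entry of `L`, and it is supported on a `2 α`-sparse set. -/
theorem opBound_init_error {α b : ℝ} (hα : 0 ≤ α) {L S S₀ : Matrix (Fin m) (Fin n) ℝ}
    (hS : IsSparse (fun i j => S i j ≠ 0) α) (hS₀ : IsHardThreshold α (L + S) S₀)
    (hL : ∀ i j, L i j ^ 2 ≤ b) (hb : 0 ≤ b) :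
    OpBound (S - S₀) (16 * α ^ 2 * (b * m * n)) := by
  classical
  obtain ⟨row, col, hrow, hcol, hT⟩ := hS₀
  have hsp := hS.or (isSparse_kept hα hrow hcol)
  have habs : ∀ i j, |L i j| ≤ Real.sqrt b := fun i j => Real.abs_le_sqrt (hL i j)
  have hbound : ∀ i j, |(S - S₀) i j| ≤ 2 * Real.sqrt b := by
    intro i j
    have hs0 := Real.sqrt_nonneg b
    rw [Matrix.sub_apply, hT]
    split_ifs with hk
    · rw [Matrix.add_apply, show S i j - (L i j + S i j) = -L i j by ring, abs_neg]
      linarith [habs i j]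
    · rw [sub_zero]
      by_cases h0 : S i j = 0
      · rw [h0, abs_zero]; positivity
      suffices h : |(L + S) i j| ≤ Real.sqrt b by
        have e : S i j = (L + S) i j - L i j := by simp
        rw [e]
        linarith [abs_sub ((L + S) i j) (L i j), habs i j]
      rw [not_and_or] at hk
      rcases hk with hk | hk
      · obtain ⟨k, hk1, hk2⟩ := (hrow i).exists_notMem_abs_le hk
          (s := Finset.univ.filter fun j => S i j ≠ 0) (by simpa using h0) (by convert! hS.1 i)
        have hz : S i k = 0 := by simpa using hk1
        rw [Matrix.add_apply L S i k, hz, add_zero] at hk2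
        exact hk2.trans (habs i k)
      · obtain ⟨k, hk1, hk2⟩ := (hcol j).exists_notMem_abs_le hk
          (s := Finset.univ.filter fun i => S i j ≠ 0) (by simpa using h0) (by convert! hS.2 j)
        have hz : S k j = 0 := by simpa using hk1
        rw [Matrix.add_apply L S k j, hz, add_zero] at hk2
        exact hk2.trans (habs k j)
  refine (hsp.opBound (c := 4 * b) (by positivity) (by positivity) ?_ ?_).mono (le_of_eq (by ring))
  · intro i j hp
    rw [not_or, not_not] at hp
    rw [Matrix.sub_apply, hT, if_neg hp.2, hp.1, sub_zero]
  · intro i j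
    have h := pow_le_pow_left₀ (abs_nonneg _) (hbound i j) 2
    rw [sq_abs, mul_pow, Real.sq_sqrt hb] at h
    linarith

open Classical in
theorem IsSparse.sum_row_div_le {p : Fin m → Fin n → Prop} {α : ℝ} (h : IsSparse p α)
    {f : Fin m → ℝ} (hf : ∀ i, 0 ≤ f i) :
    ∑ i, ∑ j, (if p i j then f i / (10 * (⌊α * n⌋₊ : ℝ)) else 0) ≤ (∑ i, f i) / 10 := by
  rw [Finset.sum_div]
  refine Finset.sum_le_sum fun i _ => ?_
  rw [← Finset.sum_filter, Finset.sum_const, nsmul_eq_mul]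
  have h1 : ((Finset.univ.filter fun j => p i j).card : ℝ) ≤ (⌊α * n⌋₊ : ℝ) := by
    exact_mod_cast Nat.le_floor (h.1 i)
  -- When the floor vanishes the row support is empty, and the summands are zero anyway because
  -- division by zero gives zero.
  rcases Nat.eq_zero_or_pos ⌊α * n⌋₊ with h0 | hpos
  · rw [h0]; simp only [Nat.cast_zero, mul_zero, div_zero]
    have := hf i
    positivity
  · have hpos' : (0 : ℝ) < (⌊α * n⌋₊ : ℝ) := by exact_mod_cast hpos
    calc _ ≤ (⌊α * n⌋₊ : ℝ) * (f i / (10 * (⌊α * n⌋₊ : ℝ))) :=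
          mul_le_mul_of_nonneg_right h1 (div_nonneg (hf i) (by positivity))
      _ = f i / 10 := by field_simp

theorem le_row_div {α : ℝ} (hα : 0 ≤ α) {a b : Fin n → ℝ} {T : Finset (Fin n)} {s : Fin n → ℝ}
    (h : IsTopFraction (11 * α) a T) (hab : ∀ k, s k = 0 → a k ^ 2 = b k ^ 2)
    {t : Finset (Fin n)} (ht : ∀ k, k ∈ t ↔ s k ≠ 0) (htc : (t.card : ℝ) ≤ α * n)
    {j : Fin n} (hj : j ∉ T) (hs : s j ≠ 0) :
    a j ^ 2 ≤ (∑ k, b k ^ 2) / (10 * (⌊α * n⌋₊ : ℝ)) := by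
  have h1 := h.sq_le_sum hα hj htc
  have hpos : 0 < ⌊α * n⌋₊ :=
    lt_of_lt_of_le (Finset.card_pos.2 ⟨j, (ht j).2 hs⟩) (Nat.le_floor htc)
  have hpos' : (0 : ℝ) < (⌊α * n⌋₊ : ℝ) := by exact_mod_cast hpos
  rw [le_div_iff₀ (by positivity), mul_comm]
  refine h1.trans ?_
  calc ∑ k ∈ tᶜ, a k ^ 2 = ∑ k ∈ tᶜ, b k ^ 2 := Finset.sum_congr rfl fun k hk => hab k (by
        have := mt (ht k).2 (Finset.mem_compl.1 hk)
        simpa using this)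
    _ ≤ ∑ k, b k ^ 2 := Finset.sum_le_sum_of_subset_of_nonneg (Finset.subset_univ _)
        fun _ _ _ => sq_nonneg _

-- A corrupted entry that escapes thresholding is dominated by `10 ⌊α n⌋` uncorrupted entries of its
-- row, or the analogous number in its column. There the thresholded matrix is `-H`, with `H = Z -
-- L`, so the escaped square is at most a `1 / (10 ⌊α n⌋)` share of the row mass of `H`. There are
-- at most `⌊α n⌋` corrupted entries per row, so all escapes together weigh at most `1/10 + 1/10` of
-- `‖H‖²`.
open Classical in
theorem threshold_residual {α : ℝ} (hα : 0 ≤ α) {L S S' Z : Matrix (Fin m) (Fin n) ℝ}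
    (hS : IsSparse (fun i j => S i j ≠ 0) α) (hT : IsHardThreshold (11 * α) (L + S - Z) S') :
    ∃ p : Fin m → Fin n → Prop, IsSparse p (12 * α) ∧
      frobSq (Z + S' - (L + S)) ≤ 6 / 5 * frobSq (Z - L) ∧
      9 / 10 * frobSq (Z - L) - 3 / 2 * ∑ i, ∑ j, (if p i j then (Z - L) i j ^ 2 else 0) ≤
        ip (Z + S' - (L + S)) (Z - L) := by
  obtain ⟨row, col, hrow, hcol, hT⟩ := hT
  have hsp := hS.or (isSparse_kept (by positivity) hrow hcol)
  set H := Z - L with hH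
  set D := Z + S' - (L + S) with hD
  -- `G` is the budget for an escaped corrupted entry; both shares are added because it may have
  -- failed either the row test or the column test.
  set G : Fin m → Fin n → ℝ := fun i j =>
    (if S i j ≠ 0 then rowSq H i / (10 * (⌊α * n⌋₊ : ℝ)) else 0) +
      (if S i j ≠ 0 then rowSq Hᵀ j / (10 * (⌊α * m⌋₊ : ℝ)) else 0) with hG
  have hG0 : ∀ i j, 0 ≤ G i j := fun i j => by
    have := rowSq_nonneg H i
    have := rowSq_nonneg Hᵀ j
    simp only [hG]; positivity
  have hGsum : ∑ i, ∑ j, G i j ≤ frobSq H / 5 := by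
    simp only [hG, Finset.sum_add_distrib]
    have h1 := hS.sum_row_div_le (f := rowSq H) fun i => rowSq_nonneg H i
    have h2 := hS.swap.sum_row_div_le (f := rowSq Hᵀ) fun i => rowSq_nonneg Hᵀ i
    rw [Finset.sum_comm, sum_rowSq, frobSq_transpose] at h2
    rw [sum_rowSq] at h1
    have h3 := add_le_add h1 h2
    have e : frobSq H / 5 = frobSq H / 10 + frobSq H / 10 := by ring
    rw [e]
    convert! h3
  have hoff : ∀ i j, S i j = 0 → (L + S - Z) i j ^ 2 = H i j ^ 2 := fun i j h0 => by
    simp only [hH, Matrix.sub_apply, Matrix.add_apply, h0]; ring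
  have hkey : ∀ i j, ¬(j ∈ row i ∧ i ∈ col j) → S i j ≠ 0 → (L + S - Z) i j ^ 2 ≤ G i j := by
    intro i j hk h0
    have e : G i j = rowSq H i / (10 * (⌊α * n⌋₊ : ℝ)) + rowSq Hᵀ j / (10 * (⌊α * m⌋₊ : ℝ)) := by
      simp only [hG, if_pos h0]
    have n1 : 0 ≤ rowSq H i / (10 * (⌊α * n⌋₊ : ℝ)) :=
      div_nonneg (rowSq_nonneg H i) (by positivity)
    have n2 : 0 ≤ rowSq Hᵀ j / (10 * (⌊α * m⌋₊ : ℝ)) :=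
      div_nonneg (rowSq_nonneg Hᵀ j) (by positivity)
    rw [e]
    rw [not_and_or] at hk
    rcases hk with hk | hk
    · have := le_row_div hα (hrow i) (s := fun k => S i k) (b := fun k => H i k)
        (fun k hk => hoff i k hk) (t := Finset.univ.filter fun j => S i j ≠ 0)
        (by simp) (by convert! hS.1 i) hk h0
      exact this.trans (le_add_of_nonneg_right n2)
    · have := le_row_div hα (hcol j) (s := fun k => S k j) (b := fun k => H k j)
        (fun k hk => hoff k j hk) (t := Finset.univ.filter fun i => S i j ≠ 0)
        (by simp) (by convert! hS.2 j) hk h0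
      exact this.trans (le_add_of_nonneg_left n1)
  have hDk : ∀ i j, (j ∈ row i ∧ i ∈ col j) → D i j = 0 := fun i j hk => by
    simp only [hD, Matrix.sub_apply, Matrix.add_apply, hT, if_pos hk]; ring
  have hDn : ∀ i j, ¬(j ∈ row i ∧ i ∈ col j) → D i j = -(L + S - Z) i j := fun i j hk => by
    simp only [hD, Matrix.sub_apply, Matrix.add_apply, hT, if_neg hk]; ring
  refine ⟨_, by convert! hsp using 1; ring, ?_, ?_⟩
  · have h1 : ∀ i j, D i j ^ 2 ≤ H i j ^ 2 + G i j := by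
      intro i j
      by_cases hk : j ∈ row i ∧ i ∈ col j
      · rw [hDk i j hk]; nlinarith [hG0 i j, sq_nonneg (H i j)]
      · rw [hDn i j hk, neg_sq]
        by_cases h0 : S i j = 0
        · rw [hoff i j h0]; linarith [hG0 i j]
        · linarith [hkey i j hk h0, sq_nonneg (H i j)]
    have h2 : frobSq D ≤ ∑ i, ∑ j, (H i j ^ 2 + G i j) :=
      Finset.sum_le_sum fun i _ => Finset.sum_le_sum fun j _ => h1 i j
    simp only [Finset.sum_add_distrib] at h2
    have e : ∑ i, ∑ j, H i j ^ 2 = frobSq H := rfl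
    linarith
  · have h1 : ∀ i j, H i j ^ 2 - 3 / 2 * (if S i j ≠ 0 ∨ j ∈ row i ∧ i ∈ col j then H i j ^ 2 else 0)
        - 1 / 2 * G i j ≤ D i j * H i j := by
      intro i j
      have hg := hG0 i j
      by_cases hk : j ∈ row i ∧ i ∈ col j
      · rw [hDk i j hk, if_pos (Or.inr hk)]; nlinarith [sq_nonneg (H i j)]
      · by_cases h0 : S i j = 0
        · have hp : ¬(S i j ≠ 0 ∨ j ∈ row i ∧ i ∈ col j) := by tauto
          rw [if_neg hp, hDn i j hk]
          have e : (L + S - Z) i j = -H i j := by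
            simp only [hH, Matrix.sub_apply, Matrix.add_apply, h0]; ring
          rw [e]; nlinarith
        · rw [if_pos (Or.inl h0)]
          have h3 := hkey i j hk h0
          rw [← neg_sq, ← hDn i j hk] at h3
          nlinarith [sq_nonneg (D i j + H i j)]
    have h2 : ∑ i, ∑ j, (H i j ^ 2 - 3 / 2 * (if S i j ≠ 0 ∨ j ∈ row i ∧ i ∈ col j then H i j ^ 2
        else 0) - 1 / 2 * G i j) ≤ ip D H :=
      Finset.sum_le_sum fun i _ => Finset.sum_le_sum fun j _ => h1 i j
    simp only [Finset.sum_sub_distrib, ← Finset.mul_sum] at h2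
    have e : ∑ i, ∑ j, H i j ^ 2 = frobSq H := rfl
    rw [e] at h2
    refine le_trans ?_ h2
    have h3 : 9 / 10 * frobSq H ≤ frobSq H - 1 / 2 * ∑ i, ∑ j, G i j := by linarith
    refine (sub_le_sub_right h3 _).trans (le_of_eq ?_)
    rw [sub_right_comm]
    congr!

end Thresholding

/-! ### One gradient step -/

section Descent

variable {n₁ n₂ d₁ d₂ r : ℕ}

theorem OpBound.orth_mul {X : Matrix (Fin n₁) (Fin d₁) ℝ} (hX : Xᵀ * X = 1)
    {P : Matrix (Fin d₁) (Fin r) ℝ} {c : ℝ} (h : OpBound P c) : OpBound (X * P) c := fun k B => by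
  rw [Matrix.mul_assoc, frobSq_mul_of_orth hX]; exact h k B

/-- Since `W` is symmetric and the target is balanced, twice the right side is `⟨W, W + E⟩`, where
`E` is quadratic in the deviations and so has squared norm at most `2 δ²`. -/
theorem ip_regularizer_ge (P P' : Matrix (Fin d₁) (Fin r) ℝ) (Q Q' : Matrix (Fin d₂) (Fin r) ℝ)
    (hbal : P'ᵀ * P' = Q'ᵀ * Q') {δ : ℝ} (hδ : δ = frobSq (P - P') + frobSq (Q - Q')) :
    1 / 4 * frobSq (Pᵀ * P - Qᵀ * Q) - 1 / 2 * δ ^ 2 ≤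
      ip (P * (Pᵀ * P - Qᵀ * Q)) (P - P') - ip (Q * (Pᵀ * P - Qᵀ * Q)) (Q - Q') := by
  set W := Pᵀ * P - Qᵀ * Q with hW
  have hWt : Wᵀ = W := by simp [hW]
  set E := (P - P')ᵀ * (P - P') - (Q - Q')ᵀ * (Q - Q') with hE
  have hs : ∀ {k : ℕ} (A C : Matrix (Fin k) (Fin r) ℝ),
      2 * ip (A * W) C = ip W (Aᵀ * C + Cᵀ * A) := by
    intro k A C
    have : ip W (Cᵀ * A) = ip W (Aᵀ * C) := by
      rw [← ip_transpose, hWt, Matrix.transpose_mul, Matrix.transpose_transpose]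
    rw [ip_mul_left, ip_add_right, this]; ring
  have e : 2 * (ip (P * W) (P - P') - ip (Q * W) (Q - Q')) = frobSq W + ip W E := by
    rw [mul_sub, hs, hs, ← ip_sub_right, frobSq_eq_ip, ← ip_add_right]
    congr 1
    simp only [hW, hE, Matrix.mul_sub, Matrix.sub_mul, Matrix.transpose_sub, hbal]
    abel
  have hEn : frobSq E ≤ 2 * δ ^ 2 := by
    have h1 := frobSq_add_le_two ((P - P')ᵀ * (P - P')) (-((Q - Q')ᵀ * (Q - Q')))
    rw [frobSq_neg, ← sub_eq_add_neg] at h1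
    have h2 := frobSq_mul_le (P - P')ᵀ (P - P')
    have h3 := frobSq_mul_le (Q - Q')ᵀ (Q - Q')
    rw [frobSq_transpose] at h2 h3
    have h4 := frobSq_nonneg (P - P')
    have h5 := frobSq_nonneg (Q - Q')
    rw [hδ]
    nlinarith [mul_nonneg h4 h5]
  have h := two_mul_ip_le W E one_pos
  have h' := neg_abs_le (ip W E)
  linarith

/-- Expand the squared distance after the step. The linear term pairs `D` with `H` up to a quadratic
remainder `C`, plus the regularizer; the curvature inequality converts the resulting multiples of
`‖H‖²` and `‖W‖²` into `σ δ`, and the ball radius makes `δ²` negligible against it. -/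
theorem descent_step {X : Matrix (Fin n₁) (Fin d₁) ℝ} {Y : Matrix (Fin n₂) (Fin d₂) ℝ}
    (hX : Xᵀ * X = 1) (hY : Yᵀ * Y = 1) (P P' : Matrix (Fin d₁) (Fin r) ℝ)
    (Q Q' : Matrix (Fin d₂) (Fin r) ℝ) (D : Matrix (Fin n₁) (Fin n₂) ℝ) {σ σ₁ η δ : ℝ}
    (hbal : P'ᵀ * P' = Q'ᵀ * Q') (hδ : δ = frobSq (P - P') + frobSq (Q - Q'))
    (hD : frobSq D ≤ 6 / 5 * frobSq (X * P * Qᵀ * Yᵀ - X * P' * Q'ᵀ * Yᵀ))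
    (hDH : 9 / 10 * frobSq (X * P * Qᵀ * Yᵀ - X * P' * Q'ᵀ * Yᵀ) - 1 / 200 * (σ * δ) ≤
      ip D (X * P * Qᵀ * Yᵀ - X * P' * Q'ᵀ * Yᵀ))
    (hδσ : δ ≤ σ / 200) (hσ₁ : 0 ≤ σ₁) (hP : OpBound P (2 * σ₁)) (hQ : OpBound Q (2 * σ₁))
    (hcurv : 8 / 5 * σ * δ ≤ 4 * frobSq (P * Qᵀ - P' * Q'ᵀ) + frobSq (Pᵀ * P - Qᵀ * Q))
    (hη : 0 < η) (hησ : η * σ₁ ≤ 1 / 100) :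
    frobSq (P - η • (Xᵀ * (D * (Y * Q)) + (1 / 16 : ℝ) • (P * (Pᵀ * P - Qᵀ * Q))) - P') +
      frobSq (Q - η • (Yᵀ * (Dᵀ * (X * P)) - (1 / 16 : ℝ) • (Q * (Pᵀ * P - Qᵀ * Q))) - Q') ≤
      (1 - 1 / 50 * η * σ) * δ := by
  have hreg := ip_regularizer_ge P P' Q Q' hbal hδ
  set W := Pᵀ * P - Qᵀ * Q with hW
  set H := X * P * Qᵀ * Yᵀ - X * P' * Q'ᵀ * Yᵀ with hH
  have hHn : frobSq H = frobSq (P * Qᵀ - P' * Q'ᵀ) := by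
    have : H = X * (P * Qᵀ - P' * Q'ᵀ) * Yᵀ := by
      simp only [hH, Matrix.mul_sub, Matrix.sub_mul, Matrix.mul_assoc]
    rw [this, frobSq_mul_transpose_of_orth hY, frobSq_mul_of_orth hX]
  rw [← hHn] at hcurv
  set h := frobSq H with hh
  set w := frobSq W with hw
  have hh0 : 0 ≤ h := frobSq_nonneg _
  have hw0 : 0 ≤ w := frobSq_nonneg _
  have hd0 : 0 ≤ frobSq D := frobSq_nonneg _
  have ha0 := frobSq_nonneg (P - P')
  have hb0 := frobSq_nonneg (Q - Q')
  have hδ0 : 0 ≤ δ := by rw [hδ]; positivity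
  set GP := Xᵀ * (D * (Y * Q)) + (1 / 16 : ℝ) • (P * W) with hGP
  set GQ := Yᵀ * (Dᵀ * (X * P)) - (1 / 16 : ℝ) • (Q * W) with hGQ
  have hnP : frobSq GP ≤ 4 * σ₁ * frobSq D + σ₁ * w / 64 := by
    have h1 := frobSq_add_le_two (Xᵀ * (D * (Y * Q))) ((1 / 16 : ℝ) • (P * W))
    have h2 := (frobSq_transpose_mul_le hX (D * (Y * Q))).trans
      ((hQ.orth_mul hY).mul_right (by positivity) D)
    have h3 := hP _ W
    rw [frobSq_smul] at h1
    linarith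
  have hnQ : frobSq GQ ≤ 4 * σ₁ * frobSq D + σ₁ * w / 64 := by
    have h1 := frobSq_add_le_two (Yᵀ * (Dᵀ * (X * P))) (-((1 / 16 : ℝ) • (Q * W)))
    have h2 := (frobSq_transpose_mul_le hY (Dᵀ * (X * P))).trans
      ((hP.orth_mul hX).mul_right (by positivity) Dᵀ)
    have h3 := hQ _ W
    rw [frobSq_neg, ← sub_eq_add_neg, frobSq_smul] at h1
    rw [frobSq_transpose] at h2
    linarith
  set C := X * (P - P') * ((Q - Q')ᵀ * Yᵀ) with hC
  have hCn : frobSq C ≤ δ ^ 2 / 4 := by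
    have e : C = X * ((P - P') * (Q - Q')ᵀ) * Yᵀ := by simp only [hC, Matrix.mul_assoc]
    rw [e, frobSq_mul_transpose_of_orth hY, frobSq_mul_of_orth hX]
    have h1 := frobSq_mul_le (P - P') (Q - Q')ᵀ
    rw [frobSq_transpose] at h1
    rw [hδ]
    nlinarith [sq_nonneg (frobSq (P - P') - frobSq (Q - Q'))]
  have hip : ip GP (P - P') + ip GQ (Q - Q') = ip D H + ip D C +
      1 / 16 * (ip (P * W) (P - P') - ip (Q * W) (Q - Q')) := by
    have e1 : ip (Xᵀ * (D * (Y * Q))) (P - P') = ip D (X * (P - P') * (Y * Q)ᵀ) := by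
      rw [ip_mul_left, Matrix.transpose_transpose, ip_mul_right]
    have e2 : ip (Yᵀ * (Dᵀ * (X * P))) (Q - Q') = ip D (X * P * (Y * (Q - Q'))ᵀ) := by
      rw [ip_mul_left, Matrix.transpose_transpose, ip_mul_right, ← ip_transpose]
      simp
    -- The linearisation of the product at the current point overshoots `H` by exactly the product
    -- of the two deviations.
    have e3 : X * (P - P') * (Y * Q)ᵀ + X * P * (Y * (Q - Q'))ᵀ = H + C := by
      simp only [hH, hC, Matrix.mul_sub, Matrix.sub_mul, Matrix.transpose_sub,
        Matrix.transpose_mul, Matrix.mul_assoc]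
      abel
    rw [← ip_add_right, ← e3, ip_add_right, ← e1, ← e2]
    simp only [hGP, hGQ, ip_add_left, ip_sub_left, ip_smul_left]
    ring
  have hDC := two_mul_ip_le D C (t := 1 / 10) (by norm_num)
  have hDC' := neg_abs_le (ip D C)
  have hδ2 : δ ^ 2 ≤ 1 / 200 * (σ * δ) := by nlinarith
  have hexp : frobSq (P - η • GP - P') + frobSq (Q - η • GQ - Q') =
      δ - 2 * η * (ip GP (P - P') + ip GQ (Q - Q')) + η ^ 2 * (frobSq GP + frobSq GQ) := by
    rw [sub_right_comm P, sub_right_comm Q, frobSq_sub (P - P'), frobSq_sub (Q - Q'), ip_smul_right, ip_smul_right,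
      frobSq_smul, frobSq_smul, ip_comm _ GP, ip_comm _ GQ, hδ]
    ring
  rw [hexp, hip]
  have hG : η ^ 2 * (frobSq GP + frobSq GQ) ≤ η * (1 / 100 * (48 / 5 * h + w / 32)) := by
    have h1 : frobSq GP + frobSq GQ ≤ σ₁ * (48 / 5 * h + w / 32) := by
      have := mul_le_mul_of_nonneg_left hD hσ₁
      linarith
    calc η ^ 2 * (frobSq GP + frobSq GQ) ≤ η ^ 2 * (σ₁ * (48 / 5 * h + w / 32)) :=
          mul_le_mul_of_nonneg_left h1 (sq_nonneg η)
      _ = η * (η * σ₁ * (48 / 5 * h + w / 32)) := by ring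
      _ ≤ _ := mul_le_mul_of_nonneg_left (mul_le_mul_of_nonneg_right hησ (by positivity)) hη.le
  -- The losses in `σ δ` are about `0.023`, while the surviving `‖H‖²` and `‖W‖²` give about `0.049`
  -- through the curvature inequality.
  have hB : σ * δ / 50 ≤ 2 * (ip D H + ip D C +
      1 / 16 * (ip (P * W) (P - P') - ip (Q * W) (Q - Q'))) - 1 / 100 * (48 / 5 * h + w / 32) := by
    linarith
  have := mul_le_mul_of_nonneg_left hB hη.le
  linarith

-- Split the error as `(A - A')B'ᵀ + A(B - B')ᵀ`. Each summand has one factor with bounded rows, so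
-- on a sparse set its mass is an `α K` share of the other factor's squared norm; only `A` and `B'`
-- need incoherent rows.
open Classical in
theorem IsSparse.sum_sq_le {p : Fin n₁ → Fin n₂ → Prop} {α K : ℝ} (hp : IsSparse p α)
    (hn₁ : 0 < n₁) (hn₂ : 0 < n₂) (A A' : Matrix (Fin n₁) (Fin r) ℝ)
    (B B' : Matrix (Fin n₂) (Fin r) ℝ) (hA : ∀ i, rowSq A i * n₁ ≤ K)
    (hB : ∀ j, rowSq B' j * n₂ ≤ K) :
    ∑ i, ∑ j, (if p i j then (A * Bᵀ - A' * B'ᵀ) i j ^ 2 else 0) ≤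
      2 * (α * K) * (frobSq (A - A') + frobSq (B - B')) := by
  have h1 := hp.sum_le hn₂ (f := rowSq (A - A')) (g := rowSq B')
    (fun i => rowSq_nonneg _ i) (fun i => rowSq_nonneg _ i) hB
  have h2 := hp.sum_le' hn₁ (f := rowSq A) (g := rowSq (B - B'))
    (fun i => rowSq_nonneg _ i) (fun i => rowSq_nonneg _ i) hA
  rw [sum_rowSq] at h1 h2
  have e : A * Bᵀ - A' * B'ᵀ = (A - A') * B'ᵀ + A * (B - B')ᵀ := by
    simp only [Matrix.sub_mul, Matrix.mul_sub, Matrix.transpose_sub]; abel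
  have h3 : ∀ i j, (if p i j then (A * Bᵀ - A' * B'ᵀ) i j ^ 2 else 0) ≤
      2 * (if p i j then rowSq (A - A') i * rowSq B' j else 0) +
      2 * (if p i j then rowSq A i * rowSq (B - B') j else 0) := by
    intro i j
    split_ifs
    · have h4 := mul_transpose_apply_sq_le (A - A') B' i j
      have h5 := mul_transpose_apply_sq_le A (B - B') i j
      rw [e, Matrix.add_apply]
      nlinarith [sq_nonneg (((A - A') * B'ᵀ) i j - (A * (B - B')ᵀ) i j)]
    · simp
  have h6 := Finset.sum_le_sum fun i (_ : i ∈ Finset.univ) =>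
    Finset.sum_le_sum fun j (_ : j ∈ Finset.univ) => h3 i j
  simp only [Finset.sum_add_distrib, ← Finset.mul_sum] at h6
  linarith

end Descent

/-! ### Truncated singular value decompositions -/

section SVD

variable {m n r p : ℕ}

theorem frobSq_diagonal_mul_eq {k : ℕ} (s : Fin r → ℝ) (B : Matrix (Fin r) (Fin k) ℝ) :
    frobSq (Matrix.diagonal s * B) = ∑ i, ∑ j, s i ^ 2 * B i j ^ 2 := by
  simp only [frobSq, Matrix.diagonal_mul, mul_pow]

theorem opBound_diagonal {s : Fin r → ℝ} {c : ℝ} (h : ∀ i, s i ^ 2 ≤ c) :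
    OpBound (Matrix.diagonal s) c := by
  intro k B
  rw [frobSq_diagonal_mul_eq, frobSq, Finset.mul_sum]
  refine Finset.sum_le_sum fun i _ => ?_
  rw [Finset.mul_sum]
  exact Finset.sum_le_sum fun j _ => mul_le_mul_of_nonneg_right (h i) (sq_nonneg _)

theorem le_frobSq_diagonal_mul {k : ℕ} {s : Fin r → ℝ} {c : ℝ} (h : ∀ i, c ≤ s i ^ 2)
    (B : Matrix (Fin r) (Fin k) ℝ) : c * frobSq B ≤ frobSq (Matrix.diagonal s * B) := by
  rw [frobSq_diagonal_mul_eq, frobSq, Finset.mul_sum]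
  refine Finset.sum_le_sum fun i _ => ?_
  rw [Finset.mul_sum]
  exact Finset.sum_le_sum fun j _ => mul_le_mul_of_nonneg_right (h i) (sq_nonneg _)

theorem submatrix_orth {U : Matrix (Fin m) (Fin p) ℝ} (hU : Uᵀ * U = 1) (h : r ≤ p) :
    (U.submatrix id (Fin.castLE h))ᵀ * U.submatrix id (Fin.castLE h) = 1 := by
  rw [Matrix.transpose_submatrix, ← Matrix.submatrix_mul _ _ _ _ _ Function.bijective_id, hU,
    Matrix.submatrix_one _ (Fin.castLE_injective h)]

theorem mul_submatrix_castLE_eq (U : Matrix (Fin m) (Fin p) ℝ) (s : Fin p → ℝ)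
    (V : Matrix (Fin n) (Fin p) ℝ) (h : r ≤ p) :
    U.submatrix id (Fin.castLE h) * Matrix.diagonal (s ∘ Fin.castLE h) *
      (V.submatrix id (Fin.castLE h))ᵀ =
    U * Matrix.diagonal (fun k : Fin p => if (k : ℕ) < r then s k else 0) * Vᵀ := by
  ext i j
  rw [Matrix.mul_apply, Matrix.mul_apply]
  simp only [Matrix.mul_diagonal, Matrix.submatrix_apply, id, Function.comp, Matrix.transpose_apply]
  have e : ∀ k : Fin p, U i k * (if (k : ℕ) < r then s k else 0) * V j k =
      if (k : ℕ) < r then U i k * s k * V j k else 0 := fun k => by split_ifs <;> simp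
  simp only [e]
  rw [← Finset.sum_filter]
  refine Finset.sum_bij (fun k _ => Fin.castLE h k) (by simp) (by simp) ?_ (by simp)
  intro k hk
  exact ⟨⟨k, (Finset.mem_filter.1 hk).2⟩, Finset.mem_univ _, rfl⟩

theorem exists_ne_zero_mul_eq_zero {a b : ℕ} (hab : a < b) (A : Matrix (Fin a) (Fin b) ℝ) :
    ∃ w : Matrix (Fin b) (Fin 1) ℝ, w ≠ 0 ∧ A * w = 0 := by
  have h : LinearMap.ker A.mulVecLin ≠ ⊥ :=
    LinearMap.ker_ne_bot_of_finrank_lt (by simpa using hab)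
  obtain ⟨x, hx, hx0⟩ := Submodule.exists_mem_ne_zero_of_ne_bot h
  refine ⟨Matrix.of fun i _ => x i, fun h0 => hx0 ?_, ?_⟩
  · ext i
    exact congrFun (congrFun h0 i) 0
  · ext i j
    have := congrFun (LinearMap.mem_ker.1 hx) i
    simpa [Matrix.mul_apply, Matrix.mulVec, dotProduct] using this

/-- The Eckart–Young argument: the span of the top `r + 1` right singular vectors contains a
non-zero vector killed by `Bᵀ`. On it `L₀ - A Bᵀ` acts as `L₀` and stretches by at least any
singular value of index `≥ r`, so all discarded singular values are bounded by the error of the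
competitor `A Bᵀ`. -/
theorem IsSVD.truncation_opBound {L₀ : Matrix (Fin m) (Fin n) ℝ} {U : Matrix (Fin m) (Fin p) ℝ}
    {s : Fin p → ℝ} {V : Matrix (Fin n) (Fin p) ℝ} (h : IsSVD L₀ U s V) (hr : r ≤ p)
    (A : Matrix (Fin m) (Fin r) ℝ) (B : Matrix (Fin n) (Fin r) ℝ) {c : ℝ} (hc : 0 ≤ c)
    (hE : OpBound (L₀ - A * Bᵀ) c) :
    OpBound (L₀ - U.submatrix id (Fin.castLE hr) * Matrix.diagonal (s ∘ Fin.castLE hr) *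
      (V.submatrix id (Fin.castLE hr))ᵀ) c := by
  have e : L₀ - U.submatrix id (Fin.castLE hr) * Matrix.diagonal (s ∘ Fin.castLE hr) *
      (V.submatrix id (Fin.castLE hr))ᵀ =
      U * (Matrix.diagonal (fun k : Fin p => if (k : ℕ) < r then 0 else s k) * Vᵀ) := by
    have hd : Matrix.diagonal s = Matrix.diagonal (fun k : Fin p => if (k : ℕ) < r then s k else 0) +
        Matrix.diagonal (fun k : Fin p => if (k : ℕ) < r then 0 else s k) := by
      rw [Matrix.diagonal_add]; congr 1; ext k; split_ifs <;> simp
    rw [mul_submatrix_castLE_eq, h.eq, hd, Matrix.mul_add, Matrix.add_mul]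
    simp [Matrix.mul_assoc]
  rw [e]
  refine OpBound.orth_mul h.orthU ?_
  have hτ : ∀ k : Fin p, (if (k : ℕ) < r then 0 else s k) ^ 2 ≤ c := by
    intro k
    split_ifs with hk
    · simpa using hc
    have hrp : r + 1 ≤ p := by omega
    obtain ⟨w, hw0, hw⟩ := exists_ne_zero_mul_eq_zero (Nat.lt_succ_self r)
      (Bᵀ * V.submatrix id (Fin.castLE hrp))
    have hwpos : 0 < frobSq w := lt_of_le_of_ne (frobSq_nonneg w)
      fun h0 => hw0 (frobSq_eq_zero h0.symm)
    have hV := submatrix_orth h.orthV hrp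
    have hU := submatrix_orth h.orthU hrp
    set V' := V.submatrix id (Fin.castLE hrp) with hV'
    have hcomb : (L₀ - A * Bᵀ) * (V' * w) = U.submatrix id (Fin.castLE hrp) *
        (Matrix.diagonal (s ∘ Fin.castLE hrp) * w) := by
      have h1 : A * Bᵀ * (V' * w) = 0 := by
        rw [Matrix.mul_assoc, ← Matrix.mul_assoc Bᵀ, hw, Matrix.mul_zero]
      have h2 : Vᵀ * V' = (1 : Matrix (Fin p) (Fin p) ℝ).submatrix id (Fin.castLE hrp) := by
        rw [← h.orthV, Matrix.submatrix_mul Vᵀ V id id (Fin.castLE hrp) Function.bijective_id]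
        simp [hV']
      have h3 : Matrix.diagonal s * (1 : Matrix (Fin p) (Fin p) ℝ).submatrix id (Fin.castLE hrp) =
          (1 : Matrix (Fin p) (Fin p) ℝ).submatrix id (Fin.castLE hrp) *
            Matrix.diagonal (s ∘ Fin.castLE hrp) := by
        ext i j
        simp only [Matrix.diagonal_mul, Matrix.mul_diagonal, Matrix.submatrix_apply, id,
          Matrix.one_apply, Function.comp]
        split_ifs with hij
        · rw [hij]; ring
        · ring
      have h4 : U * (1 : Matrix (Fin p) (Fin p) ℝ).submatrix id (Fin.castLE hrp) =
          U.submatrix id (Fin.castLE hrp) := by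
        conv_rhs => rw [← Matrix.mul_one U, Matrix.submatrix_mul U 1 id id _ Function.bijective_id]
        simp
      rw [Matrix.sub_mul, h1, sub_zero]
      conv_lhs => rw [h.eq]
      rw [Matrix.mul_assoc, ← Matrix.mul_assoc Vᵀ, h2, Matrix.mul_assoc,
        ← Matrix.mul_assoc (Matrix.diagonal s), h3, Matrix.mul_assoc, ← Matrix.mul_assoc U, h4]
    have h5 := hE _ (V' * w)
    rw [hcomb, frobSq_mul_of_orth hU, frobSq_mul_of_orth hV] at h5
    have h6 := le_frobSq_diagonal_mul (s := s ∘ Fin.castLE hrp) (c := s k ^ 2) (fun i => by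
      refine pow_le_pow_left₀ (h.nonneg k) (h.anti ?_) 2
      rw [Fin.le_def]
      have := i.2
      simp only [Fin.val_castLE]
      omega) w
    exact le_of_mul_le_mul_right (h6.trans h5) hwpos
  intro k B
  refine (opBound_diagonal hτ k _).trans ?_ |> fun h' => by rwa [Matrix.mul_assoc]
  exact mul_le_mul_of_nonneg_left (frobSq_transpose_mul_le h.orthV B) hc

/-- Split `H` into `H V Vᵀ` and its complement. The first piece is controlled by `H V`, the second
has columns in the span of `U` and is controlled by `Uᵀ H`; each costs `r c` because `V` and `U`
have `r` orthonormal columns. -/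
theorem frobSq_sub_le_of_opBound {A U : Matrix (Fin m) (Fin r) ℝ} {B V : Matrix (Fin n) (Fin r) ℝ}
    (hU : Uᵀ * U = 1) (hV : Vᵀ * V = 1) {c : ℝ} (hc : 0 ≤ c)
    (h : OpBound (A * Vᵀ - U * Bᵀ) c) : frobSq (A * Vᵀ - U * Bᵀ) ≤ 2 * r * c := by
  set H := A * Vᵀ - U * Bᵀ with hH
  have h1 : frobSq (H * V) ≤ c * r := by rw [← frobSq_of_orth hV]; exact h _ V
  have h2 : frobSq (Uᵀ * H) ≤ c * r := by
    have := h.mul_right hc Uᵀ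
    rwa [frobSq_transpose, frobSq_of_orth hU] at this
  have e1 : frobSq H = frobSq (H * V) + frobSq (H - H * V * Vᵀ) := by
    rw [frobSq_sub H (H * V * Vᵀ), frobSq_mul_transpose_of_orth hV, ip_comm, ip_mul_right,
      Matrix.transpose_transpose, ← frobSq_eq_ip]
    ring
  have e2 : H - H * V * Vᵀ = U * (Uᵀ * (H - H * V * Vᵀ)) := by
    have e : H - H * V * Vᵀ = U * (-(Bᵀ - Bᵀ * V * Vᵀ)) := by
      have e3 : A * Vᵀ * V * Vᵀ = A * Vᵀ := by rw [Matrix.mul_assoc A, hV, Matrix.mul_one]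
      simp only [hH, Matrix.sub_mul, Matrix.mul_neg, Matrix.mul_sub, e3]
      simp only [Matrix.mul_assoc]
      abel
    rw [e, ← Matrix.mul_assoc Uᵀ, hU, Matrix.one_mul]
  have e3 : frobSq (H - H * V * Vᵀ) ≤ frobSq (Uᵀ * H) := by
    rw [e2, frobSq_mul_of_orth hU]
    have e4 : Uᵀ * (H - H * V * Vᵀ) = Uᵀ * H - Uᵀ * H * V * Vᵀ := by
      simp only [Matrix.mul_sub, Matrix.mul_assoc]
    rw [e4, frobSq_sub, frobSq_mul_transpose_of_orth hV, ip_comm, ip_mul_right,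
      Matrix.transpose_transpose, ← frobSq_eq_ip]
    linarith [frobSq_nonneg (Uᵀ * H * V)]
  linarith

end SVD

/-! ### Consequences of incoherence -/

/-- The squared row norms add up to `d`, so their maximum is at least the average `d / n`. -/
theorem one_le_of_twoInfNorm_le {n d : ℕ} (hn : 0 < n) (hd : 0 < d) {A : Matrix (Fin n) (Fin d) ℝ}
    (hA : Aᵀ * A = 1) {μ : ℝ} (h : twoInfNorm A ≤ Real.sqrt (μ * d / n)) : 1 ≤ μ := by
  have hn' : (0 : ℝ) < n := by exact_mod_cast hn
  have hd' : (0 : ℝ) < d := by exact_mod_cast hd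
  have h1 : (d : ℝ) ≤ n * Real.sqrt (μ * d / n) ^ 2 := by
    calc (d : ℝ) = ∑ i, rowSq A i := (frobSq_of_orth hA).symm
      _ ≤ ∑ _i : Fin n, Real.sqrt (μ * d / n) ^ 2 :=
          Finset.sum_le_sum fun i _ => rowSq_of_twoInfNorm_le h i
      _ = _ := by rw [Finset.sum_const, Finset.card_univ, Fintype.card_fin, nsmul_eq_mul]
  rcases le_or_gt (μ * d / n) 0 with h0 | h0
  · rw [Real.sqrt_eq_zero_of_nonpos h0] at h1
    norm_num at h1
    linarith
  · rw [Real.sq_sqrt h0.le, mul_div_cancel₀ _ hn'.ne'] at h1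
    by_contra! hμ
    nlinarith

theorem rowSq_mul_le_of_twoInfNorm_le {n d : ℕ} (hn : 0 < n) {A : Matrix (Fin n) (Fin d) ℝ}
    {μ : ℝ} (hμ : 0 ≤ μ) (h : twoInfNorm A ≤ Real.sqrt (μ * d / n)) (i : Fin n) :
    rowSq A i * n ≤ μ * d := by
  have hn' : (0 : ℝ) < n := by exact_mod_cast hn
  have h1 := rowSq_of_twoInfNorm_le h i
  rw [Real.sq_sqrt (by positivity)] at h1
  exact (le_div_iff₀ hn').1 h1

/-! ### Spectral facts about the target factors -/

namespace Setting

variable {n₁ n₂ d₁ d₂ r : ℕ} (D : Setting n₁ n₂ d₁ d₂ r)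

/-- The setting with the roles of rows and columns exchanged. -/
def swap : Setting n₂ n₁ d₂ d₁ r where
  L := D.Lᵀ
  S := D.Sᵀ
  X := D.Y
  Y := D.X
  U := D.V
  σ := D.σ
  V := D.U
  α := D.α
  r_pos := D.r_pos
  svd := ⟨D.svd.orthV, D.svd.orthU, D.svd.nonneg, D.svd.anti, by
    conv_lhs => rw [D.svd.eq]
    simp [Matrix.mul_assoc]⟩
  σ_pos := D.σ_pos
  row_sparse := D.col_sparse
  col_sparse := D.row_sparse
  orthX := D.orthY
  orthY := D.orthX
  feasX := D.feasY
  feasY := D.feasX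

theorem n₁_pos (D : Setting n₁ n₂ d₁ d₂ r) : 0 < n₁ := by
  rcases Nat.eq_zero_or_pos n₁ with h | h
  · subst h
    have h1 := frobSq_of_orth D.svd.orthU
    have h2 : frobSq D.U = 0 := by simp [frobSq]
    rw [h2] at h1
    exact absurd D.r_pos (by rw [← Nat.cast_pos (α := ℝ), ← h1]; exact lt_irrefl _)
  · exact h

theorem n₂_pos (D : Setting n₁ n₂ d₁ d₂ r) : 0 < n₂ := D.swap.n₁_pos

theorem α_nonneg : 0 ≤ D.α := by
  have h := (Nat.cast_nonneg _).trans (D.row_sparse ⟨0, D.n₁_pos⟩)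
  have hn : (0 : ℝ) < n₂ := by exact_mod_cast D.n₂_pos
  exact nonneg_of_mul_nonneg_left h hn

theorem isSparse_S : IsSparse (fun i j => D.S i j ≠ 0) D.α :=
  ⟨fun i => by convert! D.row_sparse i, fun j => by convert! D.col_sparse j⟩

theorem σ_le_σ₁ (i : Fin r) : D.σ i ≤ D.σ₁ := D.svd.anti (Fin.le_def.2 (Nat.zero_le _))

theorem σr_le_σ (i : Fin r) : D.σr ≤ D.σ i := by
  refine D.svd.anti (Fin.le_def.2 ?_)
  have := i.2
  simp only
  omega

theorem σr_pos : 0 < D.σr := D.σ_pos _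

theorem σ₁_pos : 0 < D.σ₁ := D.σ_pos _

theorem σr_le_σ₁ : D.σr ≤ D.σ₁ := D.σr_le_σ _

theorem σ₁_eq : D.σ₁ = D.κ * D.σr := (div_mul_cancel₀ _ D.σr_pos.ne').symm

theorem one_le_κ : 1 ≤ D.κ := (one_le_div D.σr_pos).2 D.σr_le_σ₁

/-- `X Xᵀ` fixes the column space of `X`, which contains that of `U`. -/
theorem X_mul_Xt_mul_U : D.X * (D.Xᵀ * D.U) = D.U := by
  ext i j
  obtain ⟨z, hz⟩ := D.feasX (LinearMap.mem_range_self D.U.mulVecLin (Pi.single j 1))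
  simp only [Matrix.mulVecLin_apply] at hz
  have h : (D.X * (D.Xᵀ * D.U)) *ᵥ Pi.single j 1 = D.U *ᵥ Pi.single j 1 := by
    rw [← Matrix.mul_assoc, ← Matrix.mulVec_mulVec, ← hz, Matrix.mulVec_mulVec, Matrix.mul_assoc,
      D.orthX, Matrix.mul_one]
  have := congrFun h i
  simpa using this

theorem d₁_pos (D : Setting n₁ n₂ d₁ d₂ r) : 0 < d₁ := by
  rcases Nat.eq_zero_or_pos d₁ with h | h
  · subst h
    have h1 := frobSq_of_orth D.svd.orthU
    have h2 : frobSq D.U = 0 := by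
      rw [← D.X_mul_Xt_mul_U]
      simp [frobSq, Matrix.mul_apply]
    rw [h2] at h1
    exact absurd D.r_pos (by rw [← Nat.cast_pos (α := ℝ), ← h1]; exact lt_irrefl _)
  · exact h

theorem X_mul_Pstar :
    D.X * D.Pstar = D.U * Matrix.diagonal fun i => Real.sqrt (D.σ i) := by
  rw [Pstar, ← Matrix.mul_assoc, D.X_mul_Xt_mul_U]

theorem sq_sqrt_σ (i : Fin r) : Real.sqrt (D.σ i) ^ 2 = D.σ i := Real.sq_sqrt (D.σ_pos i).le

theorem Pstar_gram : D.Pstarᵀ * D.Pstar = Matrix.diagonal D.σ := by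
  have h : D.Pstarᵀ * D.Pstar = (D.X * D.Pstar)ᵀ * (D.X * D.Pstar) := by
    rw [Matrix.transpose_mul, Matrix.mul_assoc, ← Matrix.mul_assoc D.Xᵀ, D.orthX, Matrix.one_mul]
  rw [h, X_mul_Pstar, Matrix.transpose_mul, Matrix.mul_assoc, ← Matrix.mul_assoc D.Uᵀ,
    D.svd.orthU, Matrix.one_mul, Matrix.diagonal_transpose, Matrix.diagonal_mul_diagonal]
  congr 1
  ext i
  rw [← sq, D.sq_sqrt_σ]

theorem XPstar_mul_YQstar : (D.X * D.Pstar) * (D.Y * D.Qstar)ᵀ = D.L := by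
  have h : D.Y * D.Qstar = D.V * Matrix.diagonal fun i => Real.sqrt (D.σ i) := D.swap.X_mul_Pstar
  rw [h, X_mul_Pstar, Matrix.transpose_mul, Matrix.diagonal_transpose, Matrix.mul_assoc,
    ← Matrix.mul_assoc (Matrix.diagonal _), Matrix.diagonal_mul_diagonal]
  have e : (fun i => Real.sqrt (D.σ i) * Real.sqrt (D.σ i)) = D.σ := by
    ext i; rw [← sq, D.sq_sqrt_σ]
  rw [e, ← Matrix.mul_assoc]
  exact D.svd.eq.symm

theorem opBound_Pstar : OpBound D.Pstar D.σ₁ := by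
  have h : OpBound (D.X * D.Pstar) D.σ₁ := by
    rw [X_mul_Pstar]
    exact OpBound.orth_mul D.svd.orthU
      (opBound_diagonal fun i => (D.sq_sqrt_σ i).trans_le (D.σ_le_σ₁ i))
  intro k B
  have := h k B
  rwa [Matrix.mul_assoc, frobSq_mul_of_orth D.orthX] at this

section Rotation

variable (R : Matrix.orthogonalGroup (Fin r) ℝ)

local notation "ℛ" => (R : Matrix (Fin r) (Fin r) ℝ)

theorem rot_transpose_mul_self : (ℛ)ᵀ * ℛ = 1 := (Matrix.mem_orthogonalGroup_iff' (Fin r) ℝ).1 R.2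

theorem rot_mul_transpose_self : ℛ * (ℛ)ᵀ = 1 := (Matrix.mem_orthogonalGroup_iff (Fin r) ℝ).1 R.2

theorem opBound_Pstar_rot : OpBound (D.Pstar * ℛ) D.σ₁ := fun k B => by
  rw [Matrix.mul_assoc, ← frobSq_mul_of_orth (rot_transpose_mul_self R) B]
  exact D.opBound_Pstar k _

theorem balanced_rot : (D.Pstar * ℛ)ᵀ * (D.Pstar * ℛ) = (D.Qstar * ℛ)ᵀ * (D.Qstar * ℛ) := by
  have h : D.Qstarᵀ * D.Qstar = Matrix.diagonal D.σ := D.swap.Pstar_gram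
  rw [Matrix.transpose_mul, Matrix.transpose_mul, Matrix.mul_assoc, Matrix.mul_assoc,
    ← Matrix.mul_assoc D.Pstarᵀ, ← Matrix.mul_assoc D.Qstarᵀ, h, D.Pstar_gram]

theorem product_rot : (D.X * (D.Pstar * ℛ)) * (D.Y * (D.Qstar * ℛ))ᵀ = D.L := by
  rw [← D.XPstar_mul_YQstar]
  simp only [Matrix.transpose_mul, Matrix.mul_assoc]
  rw [← Matrix.mul_assoc ℛ, rot_mul_transpose_self, Matrix.one_mul]

theorem σr_mul_le_Pstar_rot (k : ℕ) (C : Matrix (Fin k) (Fin r) ℝ) :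
    D.σr * frobSq C ≤ frobSq (C * (D.Pstar * ℛ)ᵀ) := by
  have e : frobSq (C * (D.Pstar * ℛ)ᵀ) =
      frobSq (Matrix.diagonal (fun i => Real.sqrt (D.σ i)) * (ℛ * Cᵀ)) := by
    rw [← frobSq_transpose, Matrix.transpose_mul, Matrix.transpose_transpose,
      ← frobSq_mul_of_orth D.orthX, Matrix.mul_assoc, ← Matrix.mul_assoc D.X, X_mul_Pstar,
      Matrix.mul_assoc, frobSq_mul_of_orth D.svd.orthU]
  rw [e, ← frobSq_transpose C, ← frobSq_mul_of_orth (rot_transpose_mul_self R) Cᵀ]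
  exact le_frobSq_diagonal_mul (fun i => (D.σr_le_σ i).trans_eq (D.sq_sqrt_σ i).symm) _

theorem rowSq_X_mul_Pstar_rot_le (i : Fin n₁) :
    rowSq (D.X * (D.Pstar * ℛ)) i ≤ D.σ₁ * rowSq D.U i := by
  rw [← Matrix.mul_assoc, X_mul_Pstar, Matrix.mul_assoc]
  refine OpBound.rowSq_mul_le (fun k B => ?_) D.σ₁_pos.le D.U i
  rw [Matrix.mul_assoc, ← frobSq_mul_of_orth (rot_transpose_mul_self R) B]
  exact opBound_diagonal (fun i => (D.sq_sqrt_σ i).trans_le (D.σ_le_σ₁ i)) k _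

theorem rowSq_U_le_rowSq_X (i : Fin n₁) : rowSq D.U i ≤ rowSq D.X i := by
  conv_lhs => rw [← D.X_mul_Xt_mul_U]
  have h : OpBound (D.Xᵀ * D.U) 1 := fun k B => by
    rw [Matrix.mul_assoc, one_mul, ← frobSq_mul_of_orth D.svd.orthU B]
    exact frobSq_transpose_mul_le D.orthX _
  simpa using h.rowSq_mul_le zero_le_one D.X i

theorem opBound_of_close {P : Matrix (Fin d₁) (Fin r) ℝ}
    (h : frobSq (P - D.Pstar * ℛ) ≤ D.σr / 200) : OpBound P (2 * D.σ₁) := by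
  have h1 := (D.opBound_Pstar_rot R).add (opBound_frobSq (P - D.Pstar * ℛ))
  rw [add_sub_cancel] at h1
  refine h1.mono ?_
  have := D.σr_le_σ₁
  have := D.σr_pos
  linarith

/-- Test on the rotated first coordinate vector, where the target attains `σ₁`. This is what puts
the target orbit inside the constraint sets, whose radius depends on `P₀`. -/
theorem σ₁_le_specNorm_sq {P : Matrix (Fin d₁) (Fin r) ℝ}
    (h : frobSq (P - D.Pstar * ℛ) ≤ D.σr / 200) : D.σ₁ ≤ 2 * specNorm P ^ 2 := by
  set e : Matrix (Fin r) (Fin 1) ℝ := Matrix.single ⟨0, D.r_pos⟩ 0 1 with he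
  have hen : frobSq e = 1 := by rw [frobSq_eq_ip, ip_single]; simp [he]
  have hRe : frobSq ((ℛ)ᵀ * e) = 1 := by
    rw [frobSq_mul_of_orth (by rw [Matrix.transpose_transpose, rot_mul_transpose_self]), hen]
  have h1 : frobSq (D.Pstar * ℛ * ((ℛ)ᵀ * e)) = D.σ₁ := by
    rw [Matrix.mul_assoc, ← Matrix.mul_assoc ℛ, rot_mul_transpose_self, Matrix.one_mul,
      frobSq_eq_ip, ip_mul_left, ← Matrix.mul_assoc, D.Pstar_gram, ip_comm, he, ip_single]
    simp [σ₁]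
  have h2 := frobSq_add_le (P * ((ℛ)ᵀ * e)) (-((P - D.Pstar * ℛ) * ((ℛ)ᵀ * e)))
  have h3 := opBound_specNorm P _ ((ℛ)ᵀ * e)
  have h4 := opBound_frobSq (P - D.Pstar * ℛ) _ ((ℛ)ᵀ * e)
  rw [hRe, mul_one] at h3 h4
  have e2 : P * ((ℛ)ᵀ * e) + -((P - D.Pstar * ℛ) * ((ℛ)ᵀ * e)) =
      D.Pstar * ℛ * ((ℛ)ᵀ * e) := by rw [Matrix.sub_mul]; abel
  rw [e2, h1, frobSq_neg] at h2
  have := D.σr_le_σ₁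
  have := D.σ₁_pos
  linarith

end Rotation

/-! ### Initialization and convergence inside the ball -/

theorem sq_apply_L_le {ν : ℝ} (hU : ∀ i, rowSq D.U i * n₁ ≤ ν) (hV : ∀ j, rowSq D.V j * n₂ ≤ ν)
    (i : Fin n₁) (j : Fin n₂) : D.L i j ^ 2 ≤ (D.σ₁ * ν) ^ 2 / (n₁ * n₂) := by
  have hn₁ : (0 : ℝ) < n₁ := by exact_mod_cast D.n₁_pos
  have hn₂ : (0 : ℝ) < n₂ := by exact_mod_cast D.n₂_pos
  have h1 : D.L i j ^ 2 ≤ rowSq (D.U * Matrix.diagonal D.σ) i * rowSq D.V j := by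
    conv_lhs => rw [D.svd.eq]
    exact mul_transpose_apply_sq_le _ _ i j
  have h2 : rowSq (D.U * Matrix.diagonal D.σ) i ≤ D.σ₁ ^ 2 * rowSq D.U i :=
    (opBound_diagonal fun i => pow_le_pow_left₀ (D.σ_pos i).le (D.σ_le_σ₁ i) 2).rowSq_mul_le
      (sq_nonneg _) _ _
  have hu := rowSq_nonneg D.U i
  have hv := rowSq_nonneg D.V j
  rw [le_div_iff₀ (by positivity)]
  calc D.L i j ^ 2 * (n₁ * n₂) ≤ D.σ₁ ^ 2 * rowSq D.U i * rowSq D.V j * (n₁ * n₂) :=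
        mul_le_mul_of_nonneg_right (h1.trans (mul_le_mul_of_nonneg_right h2 hv)) (by positivity)
    _ = D.σ₁ ^ 2 * ((rowSq D.U i * n₁) * (rowSq D.V j * n₂)) := by ring
    _ ≤ D.σ₁ ^ 2 * (ν * ν) := mul_le_mul_of_nonneg_left
        (mul_le_mul (hU i) (hV j) (by positivity) (le_trans (by positivity) (hU i))) (sq_nonneg _)
    _ = _ := by ring

/-- The curvature inequality is applied to the ambient factors `U₀ Σ₀^{1/2}` and `V₀ Σ₀^{1/2}`,
which are exactly balanced; multiplying by `Xᵀ` and `Yᵀ` afterwards only shrinks distances. The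
bound on the norm of `L₀` converts the step-size condition into one on `σ₁`. -/
theorem initialization {ν : ℝ} (hU : ∀ i, rowSq D.U i * n₁ ≤ ν) (hV : ∀ j, rowSq D.V j * n₂ ≤ ν)
    (hsmall : r * (D.α * ν * D.σ₁) ^ 2 ≤ D.σr ^ 2 / 10 ^ 10) {L₀ : Matrix (Fin n₁) (Fin n₂) ℝ}
    {P₀ : Matrix (Fin d₁) (Fin r) ℝ} {Q₀ : Matrix (Fin d₂) (Fin r) ℝ} (h : D.IsStart L₀ P₀ Q₀) :
    pairDist P₀ Q₀ D.Pstar D.Qstar ^ 2 ≤ D.σr / 200 ∧ 4 / 5 * D.σ₁ ≤ specNorm L₀ := by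
  obtain ⟨S₀, U₀, s₀, V₀, hS₀, hL₀, ⟨p, hp, U', s', V', hsvd, hU₀, hs₀, hV₀⟩, hP₀, hQ₀⟩ := h
  have hn₁ : (0 : ℝ) < n₁ := by exact_mod_cast D.n₁_pos
  have hn₂ : (0 : ℝ) < n₂ := by exact_mod_cast D.n₂_pos
  have hr : (1 : ℝ) ≤ r := by exact_mod_cast D.r_pos
  have hσr := D.σr_pos
  have hσ := D.σr_le_σ₁
  set e := 16 * (D.α * ν * D.σ₁) ^ 2 with he
  have he0 : 0 ≤ e := by positivity
  have hE : OpBound (L₀ - D.L) e := by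
    have h1 := opBound_init_error D.α_nonneg D.isSparse_S hS₀ (D.sq_apply_L_le hU hV)
      (by positivity)
    have e1 : L₀ - D.L = D.S - S₀ := by rw [hL₀, M]; abel
    rw [e1]
    refine h1.mono (le_of_eq ?_)
    rw [he]; field_simp
  have hre : r * e ≤ 16 * D.σr ^ 2 / 10 ^ 10 := by rw [he]; linarith
  constructor
  · have hUo : U₀ᵀ * U₀ = 1 := by rw [hU₀]; exact submatrix_orth hsvd.orthU hp
    have hVo : V₀ᵀ * V₀ = 1 := by rw [hV₀]; exact submatrix_orth hsvd.orthV hp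
    have hs0 : ∀ i, 0 ≤ s₀ i := fun i => by rw [hs₀]; exact hsvd.nonneg _
    have htail : OpBound (L₀ - U₀ * Matrix.diagonal s₀ * V₀ᵀ) e := by
      rw [hU₀, hs₀, hV₀]
      -- The competitor is `L` itself, factored through the `r` columns of the target.
      refine hsvd.truncation_opBound hp (D.X * D.Pstar) (D.Y * D.Qstar) he0 ?_
      rw [D.XPstar_mul_YQstar]
      exact hE
    have hLB : D.L = D.U * (D.V * Matrix.diagonal D.σ)ᵀ := by
      rw [Matrix.transpose_mul, Matrix.diagonal_transpose, ← Matrix.mul_assoc]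
      exact D.svd.eq
    have hH : frobSq (U₀ * Matrix.diagonal s₀ * V₀ᵀ - D.L) ≤ 8 * (r * e) := by
      have h1 := htail.neg.add_two hE
      have e1 : -(L₀ - U₀ * Matrix.diagonal s₀ * V₀ᵀ) + (L₀ - D.L) =
          U₀ * Matrix.diagonal s₀ * V₀ᵀ - D.L := by abel
      rw [e1, hLB] at h1
      rw [hLB]
      have := frobSq_sub_le_of_opBound D.svd.orthU hVo (by positivity) h1
      linarith
    set T := Matrix.diagonal fun i => Real.sqrt (s₀ i) with hT
    have hTT : T * T = Matrix.diagonal s₀ := by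
      rw [hT, Matrix.diagonal_mul_diagonal]
      congr 1; ext i; exact Real.mul_self_sqrt (hs0 i)
    have hTt : Tᵀ = T := Matrix.diagonal_transpose _
    have hgram : ∀ {k : ℕ} (Z : Matrix (Fin k) (Fin r) ℝ), Zᵀ * Z = 1 →
        (Z * T)ᵀ * (Z * T) = Matrix.diagonal s₀ := by
      intro k Z hZ
      rw [Matrix.transpose_mul, Matrix.mul_assoc, ← Matrix.mul_assoc Zᵀ, hZ, Matrix.one_mul, hTt,
        hTT]
    obtain ⟨R, -, hsym, hpsd⟩ := exists_procrustes (U₀ * T) (V₀ * T) (D.X * D.Pstar)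
      (D.Y * D.Qstar)
    set ρ := (R : Matrix (Fin r) (Fin r) ℝ) with hρ
    have hbal : (D.X * D.Pstar * ρ)ᵀ * (D.X * D.Pstar * ρ) =
        (D.Y * D.Qstar * ρ)ᵀ * (D.Y * D.Qstar * ρ) := by
      have h1 := D.balanced_rot R
      have h2 : ∀ {a b : ℕ} (Z : Matrix (Fin a) (Fin b) ℝ) (C : Matrix (Fin b) (Fin r) ℝ),
          Zᵀ * Z = 1 → (Z * C)ᵀ * (Z * C) = Cᵀ * C := by
        intro a b Z C hZ
        rw [Matrix.transpose_mul, Matrix.mul_assoc, ← Matrix.mul_assoc Zᵀ, hZ, Matrix.one_mul]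
      rw [Matrix.mul_assoc, Matrix.mul_assoc, h2 _ _ D.orthX, h2 _ _ D.orthY]
      exact h1
    have hcurv := curvature_bound (U₀ * T) (D.X * D.Pstar * ρ) (V₀ * T) (D.Y * D.Qstar * ρ)
      hbal (σ := D.σr) (fun k C => by
        refine (D.σr_mul_le_Pstar_rot R k C).trans (le_of_eq ?_)
        rw [Matrix.mul_assoc, Matrix.transpose_mul D.X, ← Matrix.mul_assoc,
          frobSq_mul_transpose_of_orth D.orthX]) hsym hpsd
    rw [hgram U₀ hUo, hgram V₀ hVo, sub_self] at hcurv
    have e1 : U₀ * T * (V₀ * T)ᵀ = U₀ * Matrix.diagonal s₀ * V₀ᵀ := by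
      rw [Matrix.transpose_mul, hTt, Matrix.mul_assoc, ← Matrix.mul_assoc T, hTT,
        ← Matrix.mul_assoc]
    have e2 : D.X * D.Pstar * ρ * (D.Y * D.Qstar * ρ)ᵀ = D.L := by
      rw [Matrix.mul_assoc D.X, Matrix.mul_assoc D.Y]
      exact D.product_rot R
    have e3 : frobSq (0 : Matrix (Fin r) (Fin r) ℝ) = 0 := by simp [frobSq]
    rw [e1, e2, e3] at hcurv
    have hdist := pairDist_sq_le P₀ Q₀ D.Pstar D.Qstar R
    have hPd : frobSq (P₀ - D.Pstar * ρ) ≤ frobSq (U₀ * T - D.X * D.Pstar * ρ) := by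
      have : P₀ - D.Pstar * ρ = D.Xᵀ * (U₀ * T - D.X * D.Pstar * ρ) := by
        rw [hP₀, Matrix.mul_sub, Matrix.mul_assoc D.X, ← Matrix.mul_assoc D.Xᵀ D.X, D.orthX,
          Matrix.one_mul, Matrix.mul_assoc]
      rw [this]
      exact frobSq_transpose_mul_le D.orthX _
    have hQd : frobSq (Q₀ - D.Qstar * ρ) ≤ frobSq (V₀ * T - D.Y * D.Qstar * ρ) := by
      have : Q₀ - D.Qstar * ρ = D.Yᵀ * (V₀ * T - D.Y * D.Qstar * ρ) := by
        rw [hQ₀, Matrix.mul_sub, Matrix.mul_assoc D.Y, ← Matrix.mul_assoc D.Yᵀ D.Y, D.orthY,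
          Matrix.one_mul, Matrix.mul_assoc]
      rw [this]
      exact frobSq_transpose_mul_le D.orthY _
    -- The squared product error is at most `8 r e`, so `8/5 σr δ ≤ 32 r e`, far below what is
    -- needed by the size of `e`.
    have hδ : D.σr * (frobSq (U₀ * T - D.X * D.Pstar * ρ) + frobSq (V₀ * T - D.Y * D.Qstar * ρ)) ≤
        D.σr * (D.σr / 200) := by nlinarith
    have := le_of_mul_le_mul_left hδ hσr
    linarith
  · set u : Matrix (Fin r) (Fin 1) ℝ := Matrix.single ⟨0, D.r_pos⟩ 0 1 with hu
    set x : Matrix (Fin n₂) (Fin 1) ℝ := D.V * u with hx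
    have hs : frobSq u = 1 := by rw [frobSq_eq_ip, ip_single]; simp [hu]
    have hxn : frobSq x = 1 := by rw [hx, frobSq_mul_of_orth D.svd.orthV, hs]
    have hLx : frobSq (D.L * x) = D.σ₁ ^ 2 := by
      have e1 : D.L * x = D.U * (Matrix.diagonal D.σ * u) := by
        conv_lhs => rw [D.svd.eq]
        rw [hx, Matrix.mul_assoc, ← Matrix.mul_assoc D.Vᵀ, D.svd.orthV, Matrix.one_mul,
          Matrix.mul_assoc]
      rw [e1, frobSq_mul_of_orth D.svd.orthU, frobSq_eq_ip, ip_mul_left, Matrix.diagonal_transpose,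
        ip_comm, ip_single, ← Matrix.mul_assoc, Matrix.diagonal_mul_diagonal]
      simp [hu, σ₁, sq]
    have h2 := frobSq_add_le (L₀ * x) (-((L₀ - D.L) * x))
    have h3 := opBound_specNorm L₀ _ x
    have h4 := hE _ x
    have e2 : L₀ * x + -((L₀ - D.L) * x) = D.L * x := by rw [Matrix.sub_mul]; abel
    rw [e2, frobSq_neg, hLx] at h2
    rw [hxn, mul_one] at h3 h4
    have he1 : e ≤ 16 * D.σr ^ 2 / 10 ^ 10 := le_trans (by nlinarith) hre
    have hσσ : D.σr ^ 2 ≤ D.σ₁ ^ 2 := pow_le_pow_left₀ hσr.le hσ 2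
    refine le_of_sq_le_sq ?_ (specNorm_nonneg _)
    nlinarith

/-- Common core of the three cases: the ball is invariant because every step contracts. The bound
`K` on scaled rows may come from the constraint set or from the operator norm of the iterate, so
`hrows` offers both. -/
theorem linearConvergence_of_basin {K η : ℝ} {KP : Set (Matrix (Fin d₁) (Fin r) ℝ)}
    {KQ : Set (Matrix (Fin d₂) (Fin r) ℝ)} {P₀ : Matrix (Fin d₁) (Fin r) ℝ}
    {Q₀ : Matrix (Fin d₂) (Fin r) ℝ} {P : ℕ → Matrix (Fin d₁) (Fin r) ℝ}
    {Q : ℕ → Matrix (Fin d₂) (Fin r) ℝ} (hcP : Convex ℝ KP) (hcQ : Convex ℝ KQ)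
    (hmP : ∀ R : Matrix.orthogonalGroup (Fin r) ℝ, D.Pstar * (R : Matrix (Fin r) (Fin r) ℝ) ∈ KP)
    (hmQ : ∀ R : Matrix.orthogonalGroup (Fin r) ℝ, D.Qstar * (R : Matrix (Fin r) (Fin r) ℝ) ∈ KQ)
    (hrows : ∀ A ∈ KP, OpBound A (2 * D.σ₁) → ∀ i, rowSq (D.X * A) i * n₁ ≤ K)
    (hV : ∀ j, D.σ₁ * rowSq D.V j * n₂ ≤ K)
    (hα : D.α ≤ 1 / 100) (hαK : D.α * K ≤ D.σr / 10000)
    (h₀ : pairDist P₀ Q₀ D.Pstar D.Qstar ^ 2 ≤ D.σr / 200) (hη : 0 < η)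
    (hησ : η * D.σ₁ ≤ 1 / 100) (hd : D.IsDescent KP KQ η P₀ Q₀ P Q) :
    D.LinearConvergence (1 - 1 / 50 * η * D.σr) P₀ Q₀ P Q := by
  classical
  have hσr := D.σr_pos
  have hσ₁ := D.σ₁_pos
  have hρ0 : 0 ≤ 1 - 1 / 50 * η * D.σr := by
    have := mul_le_mul_of_nonneg_left D.σr_le_σ₁ hη.le
    linarith
  have hρ1 : 1 - 1 / 50 * η * D.σr ≤ 1 := by
    have := mul_pos hη hσr
    linarith
  have hstart : pairDist (P 0) (Q 0) D.Pstar D.Qstar ^ 2 ≤ pairDist P₀ Q₀ D.Pstar D.Qstar ^ 2 := by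
    obtain ⟨R, hR, -⟩ := exists_procrustes P₀ Q₀ D.Pstar D.Qstar
    rw [hR]
    exact (pairDist_sq_le _ _ _ _ R).trans (add_le_add (hd.startP.frobSq_sub_le hcP (hmP R))
      (hd.startQ.frobSq_sub_le hcQ (hmQ R)))
  have hmem : ∀ t, P t ∈ KP := by
    rintro (_ | t)
    · exact hd.startP.1
    · obtain ⟨S, -, h, -⟩ := hd.step t
      exact h.1
  -- `α ≤ 1 / 100` makes the cap `0.1` inactive.
  have hlevel : D.α + min (10 * D.α) 0.1 = 11 * D.α := by
    rw [min_eq_left (by norm_num; linarith)]; ring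
  have hstep : ∀ t, pairDist (P t) (Q t) D.Pstar D.Qstar ^ 2 ≤ D.σr / 200 →
      pairDist (P (t + 1)) (Q (t + 1)) D.Pstar D.Qstar ^ 2 ≤
        (1 - 1 / 50 * η * D.σr) * pairDist (P t) (Q t) D.Pstar D.Qstar ^ 2 := by
    intro t ht
    obtain ⟨S, hS, hPt, hQt⟩ := hd.step t
    obtain ⟨R, hR, hsym, hpsd⟩ := exists_procrustes (P t) (Q t) D.Pstar D.Qstar
    rw [hR] at ht ⊢
    refine (pairDist_sq_le _ _ _ _ R).trans ((add_le_add (hPt.frobSq_sub_le hcP (hmP R))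
      (hQt.frobSq_sub_le hcQ (hmQ R))).trans ?_)
    rw [matGrad_loss_left, matGrad_loss_right]
    rw [hlevel] at hS
    have ha := frobSq_nonneg (P t - D.Pstar * (R : Matrix (Fin r) (Fin r) ℝ))
    have hb := frobSq_nonneg (Q t - D.Qstar * (R : Matrix (Fin r) (Fin r) ℝ))
    have hPb : OpBound (P t) (2 * D.σ₁) := D.opBound_of_close R (by linarith)
    have hQb : OpBound (Q t) (2 * D.σ₁) := D.swap.opBound_of_close R
      (le_trans (le_add_of_nonneg_left ha) ht)
    obtain ⟨p, hp, hD1, hD2⟩ := threshold_residual D.α_nonneg D.isSparse_S hS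
    have eL : D.X * (D.Pstar * (R : Matrix (Fin r) (Fin r) ℝ)) *
        (D.Qstar * (R : Matrix (Fin r) (Fin r) ℝ))ᵀ * D.Yᵀ = D.L := by
      rw [← D.product_rot R]; simp only [Matrix.transpose_mul, Matrix.mul_assoc]
    have hsum : ∑ i, ∑ j, (if p i j then (D.X * P t * (Q t)ᵀ * D.Yᵀ - D.L) i j ^ 2 else 0) ≤
        2 * (12 * D.α * K) * (frobSq (P t - D.Pstar * (R : Matrix (Fin r) (Fin r) ℝ)) +
          frobSq (Q t - D.Qstar * (R : Matrix (Fin r) (Fin r) ℝ))) := by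
      have h1 := hp.sum_sq_le D.n₁_pos D.n₂_pos (D.X * P t)
        (D.X * (D.Pstar * (R : Matrix (Fin r) (Fin r) ℝ))) (D.Y * Q t)
        (D.Y * (D.Qstar * (R : Matrix (Fin r) (Fin r) ℝ))) (hrows _ (hmem t) hPb) (fun j => by
          refine le_trans (mul_le_mul_of_nonneg_right (D.swap.rowSq_X_mul_Pstar_rot_le R j)
            (Nat.cast_nonneg _)) (hV j))
      rw [D.product_rot R, ← Matrix.mul_sub, ← Matrix.mul_sub, frobSq_mul_of_orth D.orthX,
        frobSq_mul_of_orth D.orthY] at h1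
      simpa only [Matrix.transpose_mul, Matrix.mul_assoc] using h1
    set δ := frobSq (P t - D.Pstar * (R : Matrix (Fin r) (Fin r) ℝ)) +
          frobSq (Q t - D.Qstar * (R : Matrix (Fin r) (Fin r) ℝ)) with hδ
    have hδ0 : 0 ≤ δ := add_nonneg ha hb
    refine descent_step D.orthX D.orthY (P t) _ (Q t) _ _ (D.balanced_rot R) hδ
      (by rw [eL]; exact hD1) ?_ ht hσ₁.le hPb hQb ?_ hη hησ
    -- The sparse set costs `3/2 · 24 α K δ = 36 α K δ`, which is below `σr δ / 200` since `α K ≤ σr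
    -- / 10000`.
    · rw [eL]
      refine le_trans ?_ hD2
      have := mul_le_mul_of_nonneg_right hαK hδ0
      have := mul_nonneg hσr.le hδ0
      linarith
    · exact curvature_bound (P t) _ (Q t) _ (D.balanced_rot R) (D.σr_mul_le_Pstar_rot R) hsym hpsd
  have hall : ∀ t, pairDist (P t) (Q t) D.Pstar D.Qstar ^ 2 ≤
      (1 - 1 / 50 * η * D.σr) ^ t * pairDist (P 0) (Q 0) D.Pstar D.Qstar ^ 2 := by
    intro t
    induction t with
    | zero => simp
    | succ t ih =>
      have h1 : pairDist (P t) (Q t) D.Pstar D.Qstar ^ 2 ≤ D.σr / 200 :=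
        (ih.trans (mul_le_of_le_one_left (sq_nonneg _) (pow_le_one₀ hρ0 hρ1))).trans
          (hstart.trans h₀)
      refine (hstep t h1).trans ?_
      rw [pow_succ' (1 - 1 / 50 * η * D.σr), mul_assoc (1 - 1 / 50 * η * D.σr)]
      exact mul_le_mul_of_nonneg_left ih hρ0
  exact fun t => ⟨hall t, (hall t).trans (mul_le_mul_of_nonneg_left hstart (pow_nonneg hρ0 t))⟩

end Setting
-- The three incoherence regimes
namespace Setting

variable {n₁ n₂ d₁ d₂ r : ℕ} (D : Setting n₁ n₂ d₁ d₂ r)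

theorem IncoherentSVD.swap {D : Setting n₁ n₂ d₁ d₂ r} {μ : ℝ} (h : D.IncoherentSVD μ) :
    D.swap.IncoherentSVD μ := ⟨h.2, h.1⟩

theorem IncoherentSVD.one_le {D : Setting n₁ n₂ d₁ d₂ r} {μ : ℝ} (h : D.IncoherentSVD μ) :
    1 ≤ μ := one_le_of_twoInfNorm_le D.n₁_pos D.r_pos D.svd.orthU h.1

theorem IncoherentSVD.rowSq_le {D : Setting n₁ n₂ d₁ d₂ r} {μ : ℝ} (h : D.IncoherentSVD μ)
    (i : Fin n₁) : rowSq D.U i * n₁ ≤ μ * r :=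
  rowSq_mul_le_of_twoInfNorm_le D.n₁_pos (by linarith [h.one_le]) h.1 i

theorem IncoherentFeatures.swap {D : Setting n₁ n₂ d₁ d₂ r} {μ : ℝ}
    (h : D.IncoherentFeatures μ) : D.swap.IncoherentFeatures μ := ⟨h.2, h.1⟩

theorem IncoherentFeatures.one_le {D : Setting n₁ n₂ d₁ d₂ r} {μ : ℝ}
    (h : D.IncoherentFeatures μ) : 1 ≤ μ :=
  one_le_of_twoInfNorm_le D.n₁_pos D.d₁_pos D.orthX h.1

theorem IncoherentFeatures.rowSq_le {D : Setting n₁ n₂ d₁ d₂ r} {μ : ℝ}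
    (h : D.IncoherentFeatures μ) (i : Fin n₁) : rowSq D.X i * n₁ ≤ μ * max (d₁ : ℝ) d₂ := by
  have hμ := h.one_le
  exact (rowSq_mul_le_of_twoInfNorm_le D.n₁_pos (by linarith) h.1 i).trans
    (mul_le_mul_of_nonneg_left (le_max_left _ _) (by linarith))

theorem IncoherentFeatures.rowSq_le' {D : Setting n₁ n₂ d₁ d₂ r} {μ : ℝ}
    (h : D.IncoherentFeatures μ) (j : Fin n₂) : rowSq D.Y j * n₂ ≤ μ * max (d₁ : ℝ) d₂ := by
  rw [max_comm]; exact h.swap.rowSq_le j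

theorem one_le_max_dim (D : Setting n₁ n₂ d₁ d₂ r) : 1 ≤ max (d₁ : ℝ) d₂ :=
  le_max_of_le_left (by exact_mod_cast D.d₁_pos)

theorem step_mul_σ₁_le {L₀ : Matrix (Fin n₁) (Fin n₂) ℝ} {η : ℝ}
    (hL : 4 / 5 * D.σ₁ ≤ specNorm L₀) (hη : η ≤ 1 / (192 * specNorm L₀)) :
    η * D.σ₁ ≤ 1 / 100 := by
  have hσ := D.σ₁_pos
  have hs : 0 < specNorm L₀ := by linarith
  rw [le_div_iff₀ (by positivity)] at hη
  by_cases h0 : η ≤ 0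
  · nlinarith
  · nlinarith

theorem mem_setP {μ : ℝ} (h : D.IncoherentSVD μ) {P₀ : Matrix (Fin d₁) (Fin r) ℝ}
    (hP₀ : D.σ₁ ≤ 2 * specNorm P₀ ^ 2) (R : Matrix.orthogonalGroup (Fin r) ℝ) :
    D.Pstar * (R : Matrix (Fin r) (Fin r) ℝ) ∈ D.setP μ P₀ := by
  have hμ := h.one_le
  have hn : (0 : ℝ) < n₁ := by exact_mod_cast D.n₁_pos
  refine twoInfNorm_le (mul_nonneg (Real.sqrt_nonneg _) (specNorm_nonneg _)) fun i => ?_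
  refine (D.rowSq_X_mul_Pstar_rot_le R i).trans ?_
  rw [mul_pow, Real.sq_sqrt (by positivity)]
  have h1 : rowSq D.U i ≤ μ * r / n₁ := (le_div_iff₀ hn).2 (h.rowSq_le i)
  calc D.σ₁ * rowSq D.U i ≤ 2 * specNorm P₀ ^ 2 * (μ * r / n₁) :=
        mul_le_mul hP₀ h1 (rowSq_nonneg _ _) (by positivity)
    _ = _ := by ring

theorem rowSq_le_of_mem_setP {μ : ℝ} (hμ : 0 ≤ μ) {P₀ A : Matrix (Fin d₁) (Fin r) ℝ}
    (hP₀ : OpBound P₀ (2 * D.σ₁)) (hA : A ∈ D.setP μ P₀) (i : Fin n₁) :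
    rowSq (D.X * A) i * n₁ ≤ 4 * (μ * r) * D.σ₁ := by
  have hn : (0 : ℝ) < n₁ := by exact_mod_cast D.n₁_pos
  have h1 := rowSq_of_twoInfNorm_le hA i
  rw [mul_pow, Real.sq_sqrt (by positivity)] at h1
  have h2 := hP₀.specNorm_sq_le (by have := D.σ₁_pos; positivity)
  rw [← le_div_iff₀ hn]
  calc _ ≤ _ := h1
    _ ≤ 2 * μ * r / n₁ * (2 * D.σ₁) := mul_le_mul_of_nonneg_left h2 (by positivity)
    _ = _ := by ring

/-- The linear bound serves the contraction, the squared one the initialization, where the rank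
enters once more through the Frobenius norm. -/
theorem κr_rpow_bounds :
    D.κ * r ≤ (D.κ * r) ^ (3 / 2 : ℝ) ∧ 1 ≤ (D.κ * r) ^ (3 / 2 : ℝ) ∧
      r * (r * D.κ) ^ 2 ≤ ((D.κ * r) ^ (3 / 2 : ℝ)) ^ 2 := by
  have hκ := D.one_le_κ
  have hr : (1 : ℝ) ≤ r := by exact_mod_cast D.r_pos
  have h1 : 1 ≤ D.κ * r := by nlinarith
  refine ⟨?_, Real.one_le_rpow h1 (by norm_num), ?_⟩
  · exact Real.self_le_rpow_of_one_le h1 (by norm_num)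
  · have e : ((D.κ * r) ^ (3 / 2 : ℝ)) ^ 2 = (D.κ * r) ^ 3 := by
      rw [← Real.rpow_natCast _ 2, ← Real.rpow_mul (by positivity), ← Real.rpow_natCast _ 3]
      norm_num
    rw [e, mul_pow, mul_pow]
    calc (r : ℝ) * (r ^ 2 * D.κ ^ 2) = D.κ ^ 2 * r ^ 3 := by ring
      _ ≤ D.κ ^ 3 * r ^ 3 := mul_le_mul_of_nonneg_right
          (pow_le_pow_right₀ hκ (by norm_num)) (by positivity)

theorem r_κ_rpow_bounds :
    D.κ ≤ (r : ℝ) ^ (1 / 2 : ℝ) * D.κ ^ (3 / 2 : ℝ) ∧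
      r * D.κ ^ 2 ≤ ((r : ℝ) ^ (1 / 2 : ℝ) * D.κ ^ (3 / 2 : ℝ)) ^ 2 := by
  have hκ := D.one_le_κ
  have hr : (1 : ℝ) ≤ r := by exact_mod_cast D.r_pos
  have h1 : 1 ≤ (r : ℝ) ^ (1 / 2 : ℝ) := Real.one_le_rpow hr (by norm_num)
  have h2 : D.κ ≤ D.κ ^ (3 / 2 : ℝ) := Real.self_le_rpow_of_one_le hκ (by norm_num)
  constructor
  · nlinarith
  · have e1 : ((r : ℝ) ^ (1 / 2 : ℝ)) ^ 2 = r := by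
      rw [← Real.rpow_natCast, ← Real.rpow_mul (by positivity)]; norm_num
    rw [mul_pow, e1]
    exact mul_le_mul_of_nonneg_left (pow_le_pow_left₀ (by linarith) h2 2) (by positivity)

/-- The sparsity condition of the initialization, from a bound on `α ν` by a multiple of the
reciprocal of `T`. -/
theorem small_of_le_div {ν T : ℝ} (hν : 0 < ν) (hT : 0 < T) (h : D.α ≤ 1 / 10 ^ 5 / (ν * T))
    {k : ℝ} (hk : r * (k * D.κ) ^ 2 ≤ T ^ 2) :
    r * (D.α * (ν * k) * D.σ₁) ^ 2 ≤ D.σr ^ 2 / 10 ^ 10 := by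
  rw [le_div_iff₀ (by positivity)] at h
  have hα := D.α_nonneg
  have h2 : (D.α * (ν * T)) ^ 2 ≤ (1 / 10 ^ 5) ^ 2 := pow_le_pow_left₀ (by positivity) h 2
  rw [D.σ₁_eq]
  calc r * (D.α * (ν * k) * (D.κ * D.σr)) ^ 2
      = (r * (k * D.κ) ^ 2) * ((D.α * ν) ^ 2 * D.σr ^ 2) := by ring
    _ ≤ T ^ 2 * ((D.α * ν) ^ 2 * D.σr ^ 2) := mul_le_mul_of_nonneg_right hk (by positivity)
    _ = (D.α * (ν * T)) ^ 2 * D.σr ^ 2 := by ring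
    _ ≤ (1 / 10 ^ 5) ^ 2 * D.σr ^ 2 := mul_le_mul_of_nonneg_right h2 (sq_nonneg _)
    _ = _ := by ring

theorem exists_close {P₀ : Matrix (Fin d₁) (Fin r) ℝ} {Q₀ : Matrix (Fin d₂) (Fin r) ℝ}
    (h : pairDist P₀ Q₀ D.Pstar D.Qstar ^ 2 ≤ D.σr / 200) :
    ∃ R : Matrix.orthogonalGroup (Fin r) ℝ,
      frobSq (P₀ - D.Pstar * (R : Matrix (Fin r) (Fin r) ℝ)) ≤ D.σr / 200 ∧
      frobSq (Q₀ - D.Qstar * (R : Matrix (Fin r) (Fin r) ℝ)) ≤ D.σr / 200 := by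
  obtain ⟨R, hR, -⟩ := exists_procrustes P₀ Q₀ D.Pstar D.Qstar
  rw [hR] at h
  have ha := frobSq_nonneg (P₀ - D.Pstar * (R : Matrix (Fin r) (Fin r) ℝ))
  have hb := frobSq_nonneg (Q₀ - D.Qstar * (R : Matrix (Fin r) (Fin r) ℝ))
  exact ⟨R, by linarith, by linarith⟩

theorem linearConvergence_of_incoherentSVD {L₀ : Matrix (Fin n₁) (Fin n₂) ℝ}
    {P₀ : Matrix (Fin d₁) (Fin r) ℝ} {Q₀ : Matrix (Fin d₂) (Fin r) ℝ} (h : D.IsStart L₀ P₀ Q₀)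
    {η : ℝ} (hη : 0 < η) (hη' : η ≤ 1 / (192 * specNorm L₀)) {μ : ℝ} (hμ : D.IncoherentSVD μ)
    (hα : D.α ≤ 1 / 10 ^ 5 / (μ * (D.κ * r) ^ (3 / 2 : ℝ)))
    {P : ℕ → Matrix (Fin d₁) (Fin r) ℝ} {Q : ℕ → Matrix (Fin d₂) (Fin r) ℝ}
    (hd : D.IsDescent (D.setP μ P₀) (D.setQ μ Q₀) η P₀ Q₀ P Q) :
    D.LinearConvergence (1 - 1 / 50 * η * D.σr) P₀ Q₀ P Q := by
  have hμ1 := hμ.one_le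
  have hr : (1 : ℝ) ≤ r := by exact_mod_cast D.r_pos
  have hσ₁ := D.σ₁_pos
  have hσr := D.σr_pos
  have hα0 := D.α_nonneg
  obtain ⟨hT1, hT2, hT3⟩ := D.κr_rpow_bounds
  set T := (D.κ * r) ^ (3 / 2 : ℝ)
  obtain ⟨h₀, hL₀⟩ := D.initialization hμ.rowSq_le hμ.swap.rowSq_le
    (D.small_of_le_div (by linarith) (by linarith) hα hT3) h
  obtain ⟨R, hP, hQ⟩ := D.exists_close h₀
  have hαT : D.α * (μ * T) ≤ 1 / 10 ^ 5 := (le_div_iff₀ (by positivity)).1 hα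
  refine D.linearConvergence_of_basin (K := 4 * (μ * r) * D.σ₁)
    (convex_twoInfNorm_le _ (mul_nonneg (Real.sqrt_nonneg _) (specNorm_nonneg _)))
    (convex_twoInfNorm_le _ (mul_nonneg (Real.sqrt_nonneg _) (specNorm_nonneg _)))
    (D.mem_setP hμ (D.σ₁_le_specNorm_sq R hP))
    (D.swap.mem_setP hμ.swap (D.swap.σ₁_le_specNorm_sq R hQ))
    (fun A hA _ i => D.rowSq_le_of_mem_setP (by linarith) (D.opBound_of_close R hP) hA i)
    (fun j => ?_) ?_ ?_ h₀ hη (D.step_mul_σ₁_le hL₀ hη') hd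
  · have h1 := mul_le_mul_of_nonneg_left (hμ.swap.rowSq_le j) hσ₁.le
    have h2 : 0 ≤ μ * r * D.σ₁ := by positivity
    calc D.σ₁ * rowSq D.V j * n₂ = D.σ₁ * (rowSq D.V j * n₂) := mul_assoc _ _ _
      _ ≤ D.σ₁ * (μ * r) := h1
      _ ≤ _ := by linarith
  · have h1 : 1 ≤ μ * T := by nlinarith
    nlinarith
  · rw [D.σ₁_eq]
    calc D.α * (4 * (μ * r) * (D.κ * D.σr)) = 4 * (D.α * μ) * D.σr * (D.κ * r) := by ring
      _ ≤ 4 * (D.α * μ) * D.σr * T := mul_le_mul_of_nonneg_left hT1 (by positivity)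
      _ = 4 * (D.α * (μ * T)) * D.σr := by ring
      _ ≤ 4 * (1 / 10 ^ 5) * D.σr := by gcongr
      _ ≤ _ := by linarith

/-- No constraint set is needed: near the target the iterate has squared operator norm at most `2
σ₁`, so the rows of `X A` inherit incoherence from the rows of `X`. Initialization is left as a
hypothesis because cases (ii) and (iii) obtain it from different incoherence conditions. -/
theorem linearConvergence_of_incoherentFeatures {L₀ : Matrix (Fin n₁) (Fin n₂) ℝ}
    {P₀ : Matrix (Fin d₁) (Fin r) ℝ} {Q₀ : Matrix (Fin d₂) (Fin r) ℝ}
    (h₀ : pairDist P₀ Q₀ D.Pstar D.Qstar ^ 2 ≤ D.σr / 200) (hL₀ : 4 / 5 * D.σ₁ ≤ specNorm L₀)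
    {η : ℝ} (hη : 0 < η) (hη' : η ≤ 1 / (192 * specNorm L₀)) {μ : ℝ}
    (hμ : D.IncoherentFeatures μ) (hα : D.α * (μ * max (d₁ : ℝ) d₂ * D.κ) ≤ 1 / 10 ^ 5)
    {P : ℕ → Matrix (Fin d₁) (Fin r) ℝ} {Q : ℕ → Matrix (Fin d₂) (Fin r) ℝ}
    (hd : D.IsDescent Set.univ Set.univ η P₀ Q₀ P Q) :
    D.LinearConvergence (1 - 1 / 50 * η * D.σr) P₀ Q₀ P Q := by
  have hμ1 := hμ.one_le
  have hm := D.one_le_max_dim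
  have hσ₁ := D.σ₁_pos
  have hσr := D.σr_pos
  have hα0 := D.α_nonneg
  have hκ := D.one_le_κ
  set m := max (d₁ : ℝ) d₂
  have hμm : 1 ≤ μ * m := by nlinarith
  refine D.linearConvergence_of_basin (K := 4 * (μ * m) * D.σ₁) convex_univ convex_univ
    (fun _ => Set.mem_univ _) (fun _ => Set.mem_univ _) (fun A _ hA i => ?_)
    (fun j => ?_) ?_ ?_ h₀ hη (D.step_mul_σ₁_le hL₀ hη') hd
  · have h1 := mul_le_mul_of_nonneg_right (hA.rowSq_mul_le (by positivity) D.X i)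
      (Nat.cast_nonneg (α := ℝ) n₁)
    have h2 := mul_le_mul_of_nonneg_left (hμ.rowSq_le i) hσ₁.le
    have h3 : 0 ≤ D.σ₁ * (μ * m) := by positivity
    linarith
  · have h1 := mul_le_mul_of_nonneg_right (D.swap.rowSq_U_le_rowSq_X j)
      (Nat.cast_nonneg (α := ℝ) n₂)
    have h2 := mul_le_mul_of_nonneg_left (h1.trans (hμ.rowSq_le' j)) hσ₁.le
    have h3 : 0 ≤ D.σ₁ * (μ * m) := by positivity
    calc D.σ₁ * rowSq D.V j * n₂ = D.σ₁ * (rowSq D.V j * n₂) := mul_assoc _ _ _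
      _ ≤ D.σ₁ * (μ * m) := h2
      _ ≤ _ := by linarith
  · have h1 : 1 ≤ μ * m * D.κ := by nlinarith
    nlinarith
  · rw [D.σ₁_eq]
    calc D.α * (4 * (μ * m) * (D.κ * D.σr)) = 4 * (D.α * (μ * m * D.κ)) * D.σr := by ring
      _ ≤ 4 * (1 / 10 ^ 5) * D.σr := by gcongr
      _ ≤ _ := by linarith

end Setting
end RPCAF

theorem theorem2 :
    ∃ c₁ c₂ c₃ c₄ c₅ c₆ : ℝ,
      0 < c₁ ∧ 0 < c₂ ∧ 0 < c₃ ∧ 0 < c₄ ∧ 0 < c₅ ∧ 0 < c₆ ∧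
      ∀ (n₁ n₂ d₁ d₂ r : ℕ) (D : RPCAF.Setting n₁ n₂ d₁ d₂ r)
        (L₀ : Matrix (Fin n₁) (Fin n₂) ℝ)
        (P₀ : Matrix (Fin d₁) (Fin r) ℝ) (Q₀ : Matrix (Fin d₂) (Fin r) ℝ),
        D.IsStart L₀ P₀ Q₀ →
        ∀ η : ℝ, 0 < η → η ≤ 1 / (192 * RPCAF.specNorm L₀) →
        (∀ (μ₁ : ℝ) (P : ℕ → Matrix (Fin d₁) (Fin r) ℝ) (Q : ℕ → Matrix (Fin d₂) (Fin r) ℝ),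
          D.IncoherentSVD μ₁ →
          D.α ≤ c₁ / (μ₁ * (D.κ * r) ^ (3 / 2 : ℝ)) →
          D.IsDescent (D.setP μ₁ P₀) (D.setQ μ₁ Q₀) η P₀ Q₀ P Q →
          D.LinearConvergence (1 - c₂ * η * D.σr) P₀ Q₀ P Q) ∧
        (∀ (μ₂ : ℝ) (P : ℕ → Matrix (Fin d₁) (Fin r) ℝ) (Q : ℕ → Matrix (Fin d₂) (Fin r) ℝ),
          D.IncoherentFeatures μ₂ →
          D.α ≤ c₃ / (μ₂ * max (d₁ : ℝ) d₂ * (r : ℝ) ^ (1 / 2 : ℝ) * D.κ ^ (3 / 2 : ℝ)) →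
          D.IsDescent Set.univ Set.univ η P₀ Q₀ P Q →
          D.LinearConvergence (1 - c₄ * η * D.σr) P₀ Q₀ P Q) ∧
        (∀ (μ₁ μ₂ : ℝ) (P : ℕ → Matrix (Fin d₁) (Fin r) ℝ)
            (Q : ℕ → Matrix (Fin d₂) (Fin r) ℝ),
          D.IncoherentSVD μ₁ → D.IncoherentFeatures μ₂ →
          D.α ≤ c₅ * min (1 / (μ₂ * max (d₁ : ℝ) d₂ * D.κ))
            (1 / (μ₁ * (D.κ * r) ^ (3 / 2 : ℝ))) →
          D.IsDescent Set.univ Set.univ η P₀ Q₀ P Q →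
          D.LinearConvergence (1 - c₆ * η * D.σr) P₀ Q₀ P Q) := by
  refine ⟨1 / 10 ^ 5, 1 / 50, 1 / 10 ^ 5, 1 / 50, 1 / 10 ^ 5, 1 / 50, by norm_num, by norm_num,
    by norm_num, by norm_num, by norm_num, by norm_num, ?_⟩
  intro n₁ n₂ d₁ d₂ r D L₀ P₀ Q₀ h η hη hη'
  have hm := D.one_le_max_dim
  have hκ := D.one_le_κ
  refine ⟨fun μ P Q hμ hα hd => D.linearConvergence_of_incoherentSVD h hη hη' hμ hα hd,
    fun μ P Q hμ hα hd => ?_, fun μ₁ μ₂ P Q hμ₁ hμ₂ hα hd => ?_⟩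
  · have hμ1 := hμ.one_le
    obtain ⟨hT1, hT2⟩ := D.r_κ_rpow_bounds
    rw [mul_assoc (μ * max (d₁ : ℝ) d₂)] at hα
    set T := (r : ℝ) ^ (1 / 2 : ℝ) * D.κ ^ (3 / 2 : ℝ)
    have hT : 0 < T := by linarith
    -- Here the row bound is `ν = μ d` with no extra rank factor, hence `k = 1`; the `U` rows are
    -- dominated by the `X` rows.
    have hsmall := D.small_of_le_div (k := 1) (by positivity) hT hα (by rwa [one_mul])
    rw [mul_one] at hsmall
    have hU : ∀ i, RPCAF.rowSq D.U i * n₁ ≤ μ * max (d₁ : ℝ) d₂ := fun i =>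
      (mul_le_mul_of_nonneg_right (D.rowSq_U_le_rowSq_X i) (Nat.cast_nonneg _)).trans
        (hμ.rowSq_le i)
    have hV : ∀ j, RPCAF.rowSq D.V j * n₂ ≤ μ * max (d₁ : ℝ) d₂ := fun j =>
      (mul_le_mul_of_nonneg_right (D.swap.rowSq_U_le_rowSq_X j) (Nat.cast_nonneg _)).trans
        (hμ.rowSq_le' j)
    obtain ⟨h₀, hL₀⟩ := D.initialization hU hV hsmall h
    refine D.linearConvergence_of_incoherentFeatures h₀ hL₀ hη hη' hμ ?_ hd
    rw [le_div_iff₀ (by positivity)] at hα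
    refine le_trans (mul_le_mul_of_nonneg_left ?_ D.α_nonneg) hα
    exact mul_le_mul_of_nonneg_left hT1 (by positivity)
  · have hμ₁1 := hμ₁.one_le
    have hμ₂1 := hμ₂.one_le
    obtain ⟨-, hT2, hT3⟩ := D.κr_rpow_bounds
    set T := (D.κ * r) ^ (3 / 2 : ℝ)
    have hα₁ : D.α ≤ 1 / 10 ^ 5 / (μ₁ * T) := by
      rw [← mul_one_div]
      exact hα.trans (mul_le_mul_of_nonneg_left (min_le_right _ _) (by norm_num))
    have hα₂ : D.α ≤ 1 / 10 ^ 5 / (μ₂ * max (d₁ : ℝ) d₂ * D.κ) := by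
      rw [← mul_one_div]
      exact hα.trans (mul_le_mul_of_nonneg_left (min_le_left _ _) (by norm_num))
    -- Each term of the minimum has its own role: the `μ₁` bound is spent on initialization, the
    -- `μ₂` bound on contraction.
    obtain ⟨h₀, hL₀⟩ := D.initialization hμ₁.rowSq_le hμ₁.swap.rowSq_le
      (D.small_of_le_div (by linarith) (by linarith) hα₁ hT3) h
    exact D.linearConvergence_of_incoherentFeatures h₀ hL₀ hη hη' hμ₂
      ((le_div_iff₀ (by positivity)).1 hα₂) hd
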